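/- Let $\mathbb K$ be a field and let $G$ be a connected closed graph on the vertex set $[n]=\{1,\dots,n\}$, labeled so that $\{i,k\}\in E(G)$ and $i<j<k$ imply $\{i,j\},\{j,k\}\in E(G)$; equivalently, the maximal cliques of $G$ are intervals $F_i=[a_i,b_i]$, $1\le i\le t$, with $1=a_1<\cdots<a_t\le b_t=n$. ($G$ is not assumed to be Cohen--Macaulay.) In $S=\mathbb K[x_{1,v},x_{2,v}: v\in[n]]$ put $[1,2|u,v]=x_{1,u}x_{2,v}-x_{1,v}x_{2,u}$ and $\mathcal J_{K_2,G}=([1,2|u,v] : u<v,\ \{u,v\}\in E(G))$. A set $T\subseteq[n]$ is a cut set of $G$ if for every $v\in T$ the graph $G\setminus T$ has more connected components than $G\setminus(T\setminus\{v\})$; in particular $\emptyset$ is a cut set. Let $\mathfrak P_T(K_2,G)$ be the ideal generated by the variables $x_{1,v},x_{2,v}$ with $v\in T$ and the minors $[1,2|u,v]$ for $u<v$ in the same connected component of $G\setminus T$, and let $$\mathrm v_T(\mathcal J_{K_2,G})=\min\{d\ge 0 : (\mathcal J_{K_2,G}:f)=\mathfrak P_T(K_2,G)\text{ for some homogeneous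 } f\in S \text{ of degree } d\}.$$ Put $W_j=F_j\cap F_{j+1}=[a_{j+1},b_j]$ for $1\le j\le t-1$. A cut set $T$ can be written as $T=W_{j_1}\sqcup\cdots\sqcup W_{j_s}$ with $s\ge 0$, $1\le j_1<\cdots<j_s\le t-1$ and $\max W_{j_i}+1<\min W_{j_{i+1}}$ for $1\le i\le s-1$ ($s=0$ if $T=\emptyset$). Define vertices $\beta_0,\dots,\beta_s$ and $\alpha_1,\dots,\alpha_{s+1}$ as follows: $\beta_0=1$ and $\alpha_{s+1}=n$; if $s\ge1$, then $\alpha_1=a_{j_1}$ and $\beta_s=b_{j_s+1}$; and for $1\le i\le s-1$, if $b_{j_i+1}\le a_{j_{i+1}}$ then $\beta_i=b_{j_i+1}$ and $\alpha_{i+1}=a_{j_{i+1}}$, while otherwise $\beta_i=\alpha_{i+1}=\min([a_{j_{i+1}},b_{j_i+1}]\setminus T)$. A reduced connected dominating set of a graph $H$ is a set $D$ of vertices such that $H[D]$ is connected (or $D=\emptyset$) and any two distinct vertices outside $D$ are joined by a path all of whose inner vertices lie in $D$. For $0\le i\le s$ let $C_i$ be a reduced connected dominating set of minimal cardinality of the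 induced subgraph $G[\{\beta_i,\dots,\alpha_{i+1}\}]$. Let $L(T)$ be the graph with edges $\{\alpha_i,\beta_i\}$, $1\le i\le s$, and isolated vertices the elements of $C_0,\dots,C_s$, and put $$f_T=\prod_{i=1}^{s}[1,2|\alpha_i,\beta_i]\cdot\prod_{i=0}^{s}\prod_{v\in C_i}x_{1,v}.$$ Theorem. Let $T$ be a cut set of $G$. Then the construction above can be carried out, and for every choice made in it, $\mathrm v_T(\mathcal J_{K_2,G})=\deg(f_T)$. -/

import Mathlib

noncomputable section

namespace BinomialEdge

/-! ### Local v-numbers -/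

/-- The local v-number of the ideal `I` at `P`: the least degree `d` of a homogeneous polynomial
`f` with `(I : f) = P`. It takes values in `ℕ∞`, and is `⊤` exactly when there is no such `f`. -/
def localVNumber {σ K : Type*} [Field K] (I P : Ideal (MvPolynomial σ K)) : ℕ∞ :=
  ⨅ d ∈ {d : ℕ | ∃ f : MvPolynomial σ K, f.IsHomogeneous d ∧ I.colon {f} = P}, (d : ℕ∞)

/-! ### Generalized binomial edge ideals -/

/-- The 2-minor `[i, j | k, l] = x_{i,k} x_{j,l} - x_{i,l} x_{j,k}`. -/
def minor (K : Type*) [Field K] {m n : ℕ} (i j : Fin m) (k l : Fin n) :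
    MvPolynomial (Fin m × Fin n) K :=
  MvPolynomial.X (i, k) * MvPolynomial.X (j, l) - MvPolynomial.X (i, l) * MvPolynomial.X (j, k)

/-- The generalized binomial edge ideal of `(K_m, G)`. -/
def edgeIdeal (K : Type*) [Field K] (m : ℕ) {n : ℕ} (G : SimpleGraph (Fin n)) :
    Ideal (MvPolynomial (Fin m × Fin n) K) :=
  Ideal.span {p | ∃ i j : Fin m, ∃ k l : Fin n, i < j ∧ k < l ∧ G.Adj k l ∧ p = minor K i j k l}

/-- The induced subgraph `G \ T`. -/
abbrev deleteSet {n : ℕ} (G : SimpleGraph (Fin n)) (T : Finset (Fin n)) :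
    SimpleGraph {v : Fin n // v ∉ T} :=
  G.comap Subtype.val

/-- The number of connected components of `G \ T`. -/
def numComponents {n : ℕ} (G : SimpleGraph (Fin n)) (T : Finset (Fin n)) : ℕ :=
  Nat.card (deleteSet G T).ConnectedComponent

/-- `T` is a cut set: every `v ∈ T` is a cut vertex of `G \ (T \ {v})`. -/
def IsCutSet {n : ℕ} (G : SimpleGraph (Fin n)) (T : Finset (Fin n)) : Prop :=
  ∀ v ∈ T, numComponents G (T.erase v) < numComponents G T

/-- The complete graph on the vertices of a connected component of `G \ T`. -/
def completeOn {n : ℕ} (G : SimpleGraph (Fin n)) (T : Finset (Fin n))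
    (c : (deleteSet G T).ConnectedComponent) : SimpleGraph (Fin n) where
  Adj u v := u ≠ v ∧ (∃ hu : u ∉ T, (deleteSet G T).connectedComponentMk ⟨u, hu⟩ = c) ∧
    (∃ hv : v ∉ T, (deleteSet G T).connectedComponentMk ⟨v, hv⟩ = c)
  symm := ⟨fun _ _ h => ⟨h.1.symm, h.2.2, h.2.1⟩⟩
  loopless := ⟨fun _ h => h.1 rfl⟩

/-- The ideal `P_T(K_m, G)`, generated by the variables `x_{i,v}` with `v ∈ T` and by the
generalized binomial edge ideals of the complete graphs on the components of `G \ T`. -/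
def cutIdeal (K : Type*) [Field K] (m : ℕ) {n : ℕ} (G : SimpleGraph (Fin n))
    (T : Finset (Fin n)) : Ideal (MvPolynomial (Fin m × Fin n) K) :=
  Ideal.span {p | ∃ i : Fin m, ∃ v ∈ T, p = MvPolynomial.X (i, v)} ⊔
    ⨆ c : (deleteSet G T).ConnectedComponent, edgeIdeal K m (completeOn G T c)

/-! ### Closed graphs and reduced connected dominating sets -/

/-- The given labeling of the vertices makes `G` a closed graph. -/
def IsClosedGraph {n : ℕ} (G : SimpleGraph (Fin n)) : Prop :=
  ∀ i j k : Fin n, i < j → j < k → G.Adj i k → G.Adj i j ∧ G.Adj j k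

/-- Reduced connected dominating sets: the graph induced on `D` is connected (the empty graph being
allowed), and any two distinct vertices outside `D` are joined by a path whose inner vertices all
lie in `D`. -/
def IsReducedCDS {V : Type*} (H : SimpleGraph V) (D : Finset V) : Prop :=
  (H.induce (D : Set V)).Preconnected ∧
    ∀ u v : V, u ∉ D → v ∉ D → u ≠ v →
      ∃ p : H.Walk u v, p.IsPath ∧ ∀ w ∈ p.support, w ≠ u → w ≠ v → w ∈ D

/-- A reduced connected dominating set of minimal cardinality. -/
def IsMinReducedCDS {V : Type*} (H : SimpleGraph V) (D : Finset V) : Prop :=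
  IsReducedCDS H D ∧ ∀ D' : Finset V, IsReducedCDS H D' → D.card ≤ D'.card

/-! ### The graph `L(T)` and the polynomial `f_T` -/

/-- The data entering the construction of `L(T)` and `f_T` for a connected closed graph `G` and a
cut set `T`. The functions are indexed from `1` (from `0` for `β` and `C`), as indicated at each
field; values outside these ranges play no role. -/
structure LData {n : ℕ} (G : SimpleGraph (Fin n)) (T : Finset (Fin n)) where
  /-- The number of maximal cliques. -/
  t : ℕ
  /-- The left end points `a_1 < ⋯ < a_t` of the maximal cliques `F_i = [a_i, b_i]`. -/
  a : ℕ → Fin n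
  /-- The right end points `b_1, …, b_t` of the maximal cliques `F_i = [a_i, b_i]`. -/
  b : ℕ → Fin n
  t_pos : 1 ≤ t
  a_strictMono : StrictMonoOn a (Set.Icc 1 t)
  cliques : {F : Set (Fin n) | Maximal G.IsClique F} =
    {F : Set (Fin n) | ∃ i, 1 ≤ i ∧ i ≤ t ∧ F = Set.Icc (a i) (b i)}
  /-- The number of connected cut sets whose union is `T`; it is `0` when `T` is empty. -/
  s : ℕ
  /-- The indices `j_1 < ⋯ < j_s` in `[1, t - 1]` of the connected cut sets
  `W_j = F_j ∩ F_{j+1}` whose union is `T`. -/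
  j : ℕ → ℕ
  j_mem : ∀ i, 1 ≤ i → i ≤ s → 1 ≤ j i ∧ j i + 1 ≤ t
  j_strictMono : StrictMonoOn j (Set.Icc 1 s)
  T_eq : ∀ v : Fin n, v ∈ T ↔
    ∃ i, 1 ≤ i ∧ i ≤ s ∧
      v ∈ Set.Icc (a (j i)) (b (j i)) ∩ Set.Icc (a (j i + 1)) (b (j i + 1))
  /-- `max W_{j_i} + 1 < min W_{j_{i+1}}`, where `W_j = [a_{j+1}, b_j]`. -/
  gap : ∀ i, 1 ≤ i → i + 1 ≤ s → (b (j i) : ℕ) + 1 < (a (j (i + 1) + 1) : ℕ)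
  /-- The vertices `α_1, …, α_{s+1}`. -/
  α : ℕ → Fin n
  /-- The vertices `β_0, …, β_s`. -/
  β : ℕ → Fin n
  /-- `β_0` is the first vertex. -/
  β_zero : (β 0 : ℕ) = 0
  /-- `α_{s+1}` is the last vertex. -/
  α_last : (α (s + 1) : ℕ) + 1 = n
  α_one : 1 ≤ s → α 1 = a (j 1)
  β_last : 1 ≤ s → β s = b (j s + 1)
  far : ∀ i, 1 ≤ i → i + 1 ≤ s → b (j i + 1) ≤ a (j (i + 1)) →
    β i = b (j i + 1) ∧ α (i + 1) = a (j (i + 1))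
  near : ∀ i, 1 ≤ i → i + 1 ≤ s → a (j (i + 1)) < b (j i + 1) →
    β i = α (i + 1) ∧ IsLeast (Set.Icc (a (j (i + 1))) (b (j i + 1)) \ (T : Set (Fin n))) (β i)
  /-- `C_i` is a reduced connected dominating set of minimal cardinality of the subgraph of `G`
  induced on the interval `[β_i, α_{i+1}]`, for `0 ≤ i ≤ s`. -/
  C : (i : ℕ) → Finset (Set.Icc (β i) (α (i + 1)))
  C_min : ∀ i, i ≤ s → IsMinReducedCDS (G.induce (Set.Icc (β i) (α (i + 1)))) (C i)

/-- The graph `L(T)` has the edges `{α_i, β_i}`, `1 ≤ i ≤ s`, and its isolated vertices are the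
elements of the sets `C_i`, `0 ≤ i ≤ s`. The polynomial `f_T` is the product of the 2-minors
`[1, 2 | α_i, β_i]` over the edges and of the variables `x_{1,v}` over the isolated vertices. -/
def fT (K : Type*) [Field K] {n : ℕ} {G : SimpleGraph (Fin n)} {T : Finset (Fin n)}
    (D : LData G T) : MvPolynomial (Fin 2 × Fin n) K :=
  (∏ i ∈ Finset.Icc 1 D.s, minor K 0 1 (D.α i) (D.β i)) *
    ∏ i ∈ Finset.range (D.s + 1), ∏ v ∈ D.C i, MvPolynomial.X (0, v.1)

end BinomialEdge

end

/-!
The local v-number is computed by a witness and a matching lower bound, both read off from the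
interval structure of the closed graph `G`.

For a set `T'` of vertices and a labelling `κ` that is constant on the edges outside `T'`, the
substitution `x_{r,v} ↦ z_{r, κ v} y_v` (and `x_{r,v} ↦ 0` for `v ∈ T'`) is a ring homomorphism
`segreMap` into a domain whose kernel is a prime containing `J_G`. When `κ` tells the components of
`G \ T` apart, the kernel is exactly `P_T` (`ker_segreMap_le`, `IsSpine.cutIdeal_eq_ker`). No
primary decomposition or Gröbner basis of `J_G` is needed: if `(J_G : f) = P_T`, then `f` lies in
every such prime that does not contain `P_T`.

Let `W_i = [l_i, r_i]`, `1 ≤ i ≤ s`, be the blocks of `T`, so that the components of `G \ T` are the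
intervals between them. In each component, greedy steps to the farthest neighbour (`next`) lead from
`β_i` to `α_{i+1}`; let `m_i` be their number (`steps`). A reduced connected dominating set of the
interval from `β_i` to `α_{i+1}` has at least `m_i - 1` elements, because it meets all but two
levels of the greedy distance (`IsReducedCDS.le_card_add_one`), and the inner vertices of the greedy path
attain this. Hence `deg f_T = 2 s + ∑ (m_i - 1)`, with truncated subtraction.

Upper bound: let `h` be the product of the minors of the `{α_i, β_i}` and of the variables of the
first row at the inner vertices of the greedy paths (`spinePoly`). A set `C_i` need not dominate the
vertices outside it, and then `f_T` itself can fail to satisfy `(J_G : f_T) = P_T`; the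
polynomial `h` has the same degree and satisfies `(J_G : h) = P_T` (`IsSpine.colon_spinePoly`), by the relation
`x_w [u, v] = x_u [w, v] + x_v [u, w]` applied along the path.

Lower bound: let `(J_G : f) = P_T`. Then `f ∉ P_T`, as otherwise `f h ∈ J_G` and `h ∈ P_T`. Fix a
monomial `y^μ` in the image of `f` under the parametrization of `P_T`. Suitable sets `T'` show that
`μ` meets the vertices passed in each greedy step before the last, the vertices between `r_i` and
`β_i`, and those between `α_{i+1}` and `l_{i+1}`. These sets are disjoint if `β_i < α_{i+1}`, and
they are as many as required. If `β_i = α_{i+1}` with `1 ≤ i < s`, then putting back the block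
`W_i` or `W_{i+1}` shows that the coefficient of `y^μ` vanishes when the component is merged with
either neighbour; a nonzero polynomial that is at most linear in the two variables of the component
cannot do this (`eq_zero_of_linear_of_rename`), so `μ` has degree at least two there. Adding up the
components (`IsSpine.le_sum_block`) gives the bound.

The data of the construction exist because the maximal cliques are the intervals from `v` to its
farthest neighbour, for the vertices `v` at which the farthest neighbour jumps, and because each
vertex of a cut set has neighbours on both sides in different components, which forces the maximal
intervals in `T` to be intersections of consecutive maximal cliques (`IsCutSet.exists_index`).
-/

noncomputable section

namespace BinomialEdge

open MvPolynomial

variable {K : Type*} [Field K] {n : ℕ}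

/-! ### The Segre parametrization of the primes attached to vertex sets -/

/-- The parametrization of the variety of `P_T`: the variable `x_{r,v}` is sent to `0` if `v ∈ T`,
and otherwise to `z_{r, κ v} y_v`, where `κ v` is a label of the part containing `v`. The target is
a polynomial ring in the `y_v` over the polynomial ring in the `z_{r,k}`, so that coefficients of
monomials in `y` are polynomials in `z`. -/
def segreMap (K : Type*) [Field K] {n : ℕ} (T : Finset (Fin n)) (κ : Fin n → ℕ) :
    MvPolynomial (Fin 2 × Fin n) K →ₐ[K] MvPolynomial (Fin n) (MvPolynomial (Fin 2 × ℕ) K) :=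
  aeval fun p => if p.2 ∈ T then 0 else monomial (Finsupp.single p.2 1) (X (p.1, κ p.2))

theorem segreMap_X (T : Finset (Fin n)) (κ : Fin n → ℕ) (r : Fin 2) (v : Fin n) :
    segreMap K T κ (X (r, v)) =
      if v ∈ T then 0 else monomial (Finsupp.single v 1) (X (r, κ v)) := by
  simp [segreMap]

theorem segreMap_monomial (T : Finset (Fin n)) (κ : Fin n → ℕ) (m : Fin 2 × Fin n →₀ ℕ) (a : K) :
    segreMap K T κ (monomial m a) =
      if ∃ p ∈ m.support, p.2 ∈ T then 0
      else monomial (m.mapDomain Prod.snd) (monomial (m.mapDomain (Prod.map id κ)) a) := by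
  classical
  have key : ∀ m : Fin 2 × Fin n →₀ ℕ, segreMap K T κ (monomial m 1) =
      if ∃ p ∈ m.support, p.2 ∈ T then 0
      else monomial (m.mapDomain Prod.snd) (monomial (m.mapDomain (Prod.map id κ)) 1) := by
    intro m
    induction m using Finsupp.induction_linear with
    | zero => simp
    | add m m' h h' =>
      have e : (monomial (m + m') (1 : K)) = monomial m 1 * monomial m' 1 := by
        simp [monomial_mul]
      have hs : (∃ p ∈ (m + m').support, p.2 ∈ T) ↔
          (∃ p ∈ m.support, p.2 ∈ T) ∨ ∃ p ∈ m'.support, p.2 ∈ T := by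
        simp only [Finsupp.mem_support_iff, Finsupp.add_apply, ne_eq, Nat.add_eq_zero_iff, not_and_or]
        constructor
        · rintro ⟨p, h | h, hp⟩
          · exact Or.inl ⟨p, h, hp⟩
          · exact Or.inr ⟨p, h, hp⟩
        · rintro (⟨p, h, hp⟩ | ⟨p, h, hp⟩)
          · exact ⟨p, Or.inl h, hp⟩
          · exact ⟨p, Or.inr h, hp⟩
      rw [e, map_mul, h, h']
      simp only [hs]
      by_cases h1 : ∃ p ∈ m.support, p.2 ∈ T
      · rw [if_pos h1, if_pos (Or.inl h1), zero_mul]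
      by_cases h2 : ∃ p ∈ m'.support, p.2 ∈ T
      · rw [if_pos h2, if_pos (Or.inr h2), mul_zero]
      rw [if_neg h1, if_neg h2, if_neg (not_or.2 ⟨h1, h2⟩), monomial_mul, monomial_mul,
        Finsupp.mapDomain_add, Finsupp.mapDomain_add, one_mul]
    | single p k =>
      obtain ⟨r, v⟩ := p
      rcases Nat.eq_zero_or_pos k with rfl | hk
      · simp
      have e : (monomial (Finsupp.single (r, v) k) (1 : K)) = X (r, v) ^ k := by
        rw [X_pow_eq_monomial]
      have hs : (∃ p ∈ (Finsupp.single (r, v) k).support, p.2 ∈ T) ↔ v ∈ T := by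
        simp [hk.ne']
      rw [e, map_pow, segreMap_X]
      simp only [hs]
      split_ifs with h
      · exact zero_pow hk.ne'
      · rw [monomial_pow, Finsupp.mapDomain_single, Finsupp.mapDomain_single, X_pow_eq_monomial]
        simp
  have e : monomial m a = C a * monomial m 1 := by simp [C_mul_monomial]
  rw [e, map_mul, key, ← algebraMap_eq, AlgHom.commutes]
  split_ifs
  · simp
  · have : algebraMap K (MvPolynomial (Fin n) (MvPolynomial (Fin 2 × ℕ) K)) a = C (C a) := rfl
    rw [this, C_mul_monomial, C_mul_monomial, mul_one]

theorem mem_support_mapDomain_snd {m : Fin 2 × Fin n →₀ ℕ} {v : Fin n} :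
    v ∈ (m.mapDomain Prod.snd).support ↔ ∃ p ∈ m.support, p.2 = v := by
  classical
  constructor
  · intro h
    have := Finsupp.mapDomain_support h
    simpa using this
  · rintro ⟨p, hp, rfl⟩
    rw [Finsupp.mem_support_iff] at hp ⊢
    intro h
    apply hp
    have h2 : (m.mapDomain Prod.snd) p.2 = m.sum fun q k => if q.2 = p.2 then k else 0 := by
      rw [Finsupp.mapDomain, Finsupp.sum_apply]
      simp [Finsupp.single_apply]
    rw [h2, Finsupp.sum, Finset.sum_eq_zero_iff] at h
    by_contra h3
    have := h p (by simpa using h3)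
    simp at this
    exact h3 this

/-- Merging labels by `g` acts on the coefficients of monomials in the `y_v` by renaming the `z`
variables; only the labels and the deleted vertices in the support of the monomial matter. -/
theorem coeff_segreMap_eq_rename {T₁ T₂ : Finset (Fin n)} {κ₁ κ₂ : Fin n → ℕ} (g : ℕ → ℕ)
    (μ : Fin n →₀ ℕ) (hT : ∀ v ∈ μ.support, (v ∈ T₁ ↔ v ∈ T₂))
    (hκ : ∀ v ∈ μ.support, v ∉ T₁ → g (κ₁ v) = κ₂ v) (f : MvPolynomial (Fin 2 × Fin n) K) :
    coeff μ (segreMap K T₂ κ₂ f) = rename (Prod.map id g) (coeff μ (segreMap K T₁ κ₁ f)) := by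
  classical
  induction f using MvPolynomial.induction_on' with
  | monomial m a =>
    rw [segreMap_monomial, segreMap_monomial]
    by_cases hm : m.mapDomain Prod.snd = μ
    · subst hm
      have hiff : (∃ p ∈ m.support, p.2 ∈ T₂) ↔ ∃ p ∈ m.support, p.2 ∈ T₁ := by
        refine exists_congr fun p => and_congr_right fun hp => ?_
        exact (hT p.2 (mem_support_mapDomain_snd.2 ⟨p, hp, rfl⟩)).symm
      simp only [hiff]
      split_ifs with h
      · simp
      · push Not at h
        rw [coeff_monomial, if_pos rfl, coeff_monomial, if_pos rfl, rename_monomial,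
          ← Finsupp.mapDomain_comp]
        have e : m.mapDomain (Prod.map id g ∘ Prod.map id κ₁) = m.mapDomain (Prod.map id κ₂) := by
          refine Finsupp.mapDomain_congr fun p hp => ?_
          have := hκ p.2 (mem_support_mapDomain_snd.2 ⟨p, hp, rfl⟩) (h p hp)
          exact Prod.ext rfl this
        rw [e]
    · split_ifs <;> simp [coeff_monomial, hm]
  | add p q hp hq => rw [map_add, map_add, coeff_add, coeff_add, hp, hq, map_add]

theorem weight_mapDomain {σ τ : Type*} (f : σ → τ) (w : τ → ℕ) (m : σ →₀ ℕ) :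
    Finsupp.weight w (m.mapDomain f) = Finsupp.weight (w ∘ f) m := by
  simp only [Finsupp.weight_apply]
  rw [Finsupp.sum_mapDomain_index (by simp) (by intros; simp [add_mul])]
  rfl

theorem coeff_segreMap_eq_zero_of_mem {T : Finset (Fin n)} {κ : Fin n → ℕ} {μ : Fin n →₀ ℕ}
    {v : Fin n} (hv : v ∈ T) (hμ : μ v ≠ 0) (f : MvPolynomial (Fin 2 × Fin n) K) :
    coeff μ (segreMap K T κ f) = 0 := by
  classical
  induction f using MvPolynomial.induction_on' with
  | monomial m a =>
    rw [segreMap_monomial]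
    split_ifs with h
    · simp
    · rw [coeff_monomial, if_neg]
      rintro rfl
      obtain ⟨p, hp, rfl⟩ := mem_support_mapDomain_snd.1 (Finsupp.mem_support_iff.2 hμ)
      exact h ⟨p, hp, hv⟩
  | add p q hp hq => rw [map_add, coeff_add, hp, hq, add_zero]

/-- A homogeneous polynomial of degree `d` only produces monomials of degree `d` in the `y_v`. -/
theorem sum_eq_of_coeff_segreMap_ne_zero {T : Finset (Fin n)} {κ : Fin n → ℕ} {μ : Fin n →₀ ℕ}
    {f : MvPolynomial (Fin 2 × Fin n) K} {d : ℕ} (hf : f.IsHomogeneous d)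
    (hμ : coeff μ (segreMap K T κ f) ≠ 0) : ∑ v, μ v = d := by
  classical
  rw [f.as_sum, map_sum, coeff_sum] at hμ
  obtain ⟨m, hm, hne⟩ := Finset.exists_ne_zero_of_sum_ne_zero hμ
  rw [segreMap_monomial] at hne
  split_ifs at hne with h
  · simp at hne
  · rw [coeff_monomial] at hne
    split_ifs at hne with h2
    · subst h2
      have h3 := hf (mem_support_iff.1 hm)
      have e := weight_mapDomain Prod.snd (1 : Fin n → ℕ) m
      rw [Finsupp.weight_eq_sum] at e
      rw [← h3]
      simpa using e
    · exact absurd rfl hne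

/-- The coefficient of `y^μ` is homogeneous in the two variables `z_{0,i}`, `z_{1,i}`, of degree the
`y`-degree of `μ` in the part with label `i`. -/
theorem coeff_segreMap_isWeightedHomogeneous (T : Finset (Fin n)) (κ : Fin n → ℕ) (i : ℕ)
    (μ : Fin n →₀ ℕ) (f : MvPolynomial (Fin 2 × Fin n) K) :
    IsWeightedHomogeneous (fun q : Fin 2 × ℕ => if q.2 = i then 1 else 0)
      (coeff μ (segreMap K T κ f)) (∑ v with κ v = i, μ v) := by
  classical
  induction f using MvPolynomial.induction_on' with
  | monomial m a =>
    rw [segreMap_monomial]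
    split_ifs with h
    · simpa using isWeightedHomogeneous_zero _ _ _
    · rw [coeff_monomial]
      split_ifs with h2
      · subst h2
        refine isWeightedHomogeneous_monomial _ _ _ ?_
        rw [weight_mapDomain, Finset.sum_filter]
        have e := weight_mapDomain Prod.snd (fun v => if κ v = i then 1 else 0) m
        rw [Finsupp.weight_eq_sum] at e
        refine e.symm.trans (Finset.sum_congr rfl fun v _ => ?_)
        simp
      · exact isWeightedHomogeneous_zero _ _ _
  | add p q hp hq => rw [map_add, coeff_add]; exact hp.add hq

/-- The substitution of `q 0`, `q 1` for the two variables `z_{0,i}`, `z_{1,i}` with label `i`. -/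
def labelSubst (i : ℕ) (q : Fin 2 → MvPolynomial (Fin 2 × ℕ) K) :
    MvPolynomial (Fin 2 × ℕ) K →ₐ[K] MvPolynomial (Fin 2 × ℕ) K :=
  aeval fun p => if p.2 = i then q p.1 else X p

theorem rename_update_eq_labelSubst (i l : ℕ) :
    rename (Prod.map id (Function.update id i l)) =
      labelSubst i fun r => (X (r, l) : MvPolynomial (Fin 2 × ℕ) K) := by
  refine MvPolynomial.algHom_ext fun p => ?_
  obtain ⟨r, a⟩ := p
  by_cases hp : a = i <;> simp [labelSubst, hp]

theorem labelSubst_X_self (i : ℕ) :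
    (labelSubst i fun r => (X (r, i) : MvPolynomial (Fin 2 × ℕ) K)) = AlgHom.id K _ := by
  refine MvPolynomial.algHom_ext fun p => ?_
  by_cases hp : p.2 = i
  · simp [labelSubst, ← hp]
  · simp [labelSubst, hp]

theorem labelSubst_monomial (i : ℕ) (q : Fin 2 → MvPolynomial (Fin 2 × ℕ) K)
    (e : Fin 2 × ℕ →₀ ℕ) (a : K) (he : ∀ r, e (r, i) = 0) :
    labelSubst i q (monomial e a) = monomial e a := by
  rw [labelSubst, aeval_monomial, monomial_eq]
  refine congrArg _ (Finsupp.prod_congr fun p hp => ?_)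
  rw [if_neg]
  rintro rfl
  exact (Finsupp.mem_support_iff.1 hp) (he p.1)

theorem add_eq_of_mem_support_of_isWeightedHomogeneous {i d : ℕ} {F : MvPolynomial (Fin 2 × ℕ) K}
    (hF : IsWeightedHomogeneous (fun q : Fin 2 × ℕ => if q.2 = i then 1 else 0) F d)
    {e : Fin 2 × ℕ →₀ ℕ} (he : e ∈ F.support) : e (0, i) + e (1, i) = d := by
  have h := hF (mem_support_iff.1 he)
  have hw : ∀ p ∈ e.support, (e p • if p.2 = i then 1 else 0) =
      (if p = (0, i) then e p else 0) + if p = (1, i) then e p else 0 := by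
    rintro ⟨r, l⟩ _
    by_cases hl : l = i <;> fin_cases r <;> simp [hl]
  rw [Finsupp.weight_apply, Finsupp.sum, Finset.sum_congr rfl hw, Finset.sum_add_distrib,
    Finset.sum_ite_eq', Finset.sum_ite_eq'] at h
  simp only [Finsupp.mem_support_iff, ne_eq, ite_not] at h
  split_ifs at h <;> omega

theorem exists_labelSubst_eq_of_isWeightedHomogeneous_one {i : ℕ} {F : MvPolynomial (Fin 2 × ℕ) K}
    (hF : IsWeightedHomogeneous (fun q : Fin 2 × ℕ => if q.2 = i then 1 else 0) F 1) :
    ∃ A B : MvPolynomial (Fin 2 × ℕ) K, ∀ q, labelSubst i q F = A * q 0 + B * q 1 := by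
  classical
  have : ∀ e ∈ F.support, ∃ A B : MvPolynomial (Fin 2 × ℕ) K, ∀ q,
      labelSubst i q (monomial e (coeff e F)) = A * q 0 + B * q 1 := by
    intro e he
    obtain ⟨r, hr, hr'⟩ : ∃ r, e (r, i) = 1 ∧
        ∀ r', (e - Finsupp.single (r, i) 1 : Fin 2 × ℕ →₀ ℕ) (r', i) = 0 := by
      rcases Nat.add_eq_one_iff.1 (add_eq_of_mem_support_of_isWeightedHomogeneous hF he) with
        ⟨h, h'⟩ | ⟨h, h'⟩
      · exact ⟨1, h', Fin.forall_fin_two.2 (by simp [h, h'])⟩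
      · exact ⟨0, h, Fin.forall_fin_two.2 (by simp [h, h'])⟩
    set e' := e - Finsupp.single (r, i) 1 with he'
    have hsum : monomial e (coeff e F) = monomial e' (coeff e F) * X (r, i) := by
      have : e' + Finsupp.single (r, i) 1 = e := by
        ext p
        by_cases hp : p = (r, i)
        · subst hp; simp [he', hr]
        · simp [he', Ne.symm hp]
      rw [X, monomial_mul, mul_one, this]
    refine ⟨if r = 0 then monomial e' (coeff e F) else 0,
      if r = 1 then monomial e' (coeff e F) else 0, fun q => ?_⟩
    rw [hsum, map_mul, labelSubst_monomial i q e' _ hr']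
    have : labelSubst i q (X (r, i)) = q r := by simp [labelSubst]
    rw [this]
    fin_cases r <;> simp
  choose! A B hAB using this
  refine ⟨∑ e ∈ F.support, A e, ∑ e ∈ F.support, B e, fun q => ?_⟩
  conv_lhs => rw [F.as_sum, map_sum]
  rw [Finset.sum_congr rfl fun e he => hAB e he q, Finset.sum_add_distrib, Finset.sum_mul,
    Finset.sum_mul]

theorem label_minor_ne_zero {j k : ℕ} (hjk : j ≠ k) :
    (X (0, j) * X (1, k) - X (0, k) * X (1, j) : MvPolynomial (Fin 2 × ℕ) K) ≠ 0 := by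
  intro h
  have := congrArg (eval fun p : Fin 2 × ℕ =>
    if p = (0, j) ∨ p = (1, k) then (1 : K) else 0) h
  simp [hjk, hjk.symm] at this

/-- A polynomial of degree at most one in two variables `z_{0,i}`, `z_{1,i}` that vanishes when
these are replaced by the variables with label `j`, and also when they are replaced by the variables
with label `k`, is zero: its two coefficients are a solution of a homogeneous linear system whose
determinant is a nonzero minor. -/
theorem eq_zero_of_linear_of_rename {i j k : ℕ} (hjk : j ≠ k)
    {F : MvPolynomial (Fin 2 × ℕ) K} {d : ℕ} (hd : d ≤ 1)
    (hF : IsWeightedHomogeneous (fun q : Fin 2 × ℕ => if q.2 = i then 1 else 0) F d)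
    (h1 : rename (Prod.map id (Function.update id i j)) F = 0)
    (h2 : rename (Prod.map id (Function.update id i k)) F = 0) : F = 0 := by
  classical
  rw [rename_update_eq_labelSubst] at h1 h2
  rcases Nat.le_one_iff_eq_zero_or_eq_one.1 hd with rfl | rfl
  · rw [F.as_sum, map_sum] at h1
    rw [F.as_sum, ← h1]
    exact Finset.sum_congr rfl fun e he => (labelSubst_monomial i _ e _ (Fin.forall_fin_two.2
      (Nat.add_eq_zero_iff.1 (add_eq_of_mem_support_of_isWeightedHomogeneous hF he)))).symm
  · obtain ⟨A, B, hAB⟩ := exists_labelSubst_eq_of_isWeightedHomogeneous_one hF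
    rw [hAB] at h1 h2
    have hA : A = 0 := by
      have : A * (X (0, j) * X (1, k) - X (0, k) * X (1, j)) = 0 := by
        linear_combination X (1, k) * h1 - X (1, j) * h2
      exact (mul_eq_zero.1 this).resolve_right (label_minor_ne_zero hjk)
    have hB : B = 0 := by
      rw [hA, zero_mul, zero_add] at h1
      exact (mul_eq_zero.1 h1).resolve_right (X_ne_zero _)
    have := hAB fun r => X (r, i)
    rwa [labelSubst_X_self, AlgHom.id_apply, hA, hB, zero_mul, zero_mul, add_zero] at this

/-! ### Edge ideals, and the primes as kernels -/

theorem minor_self (r q : Fin 2) (u : Fin n) : minor K r q u u = 0 := by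
  simp only [minor]; ring

theorem minor_swap (r q : Fin 2) (u v : Fin n) : minor K r q u v = -minor K r q v u := by
  simp only [minor]; ring

theorem minor_mem_edgeIdeal {G : SimpleGraph (Fin n)} {u v : Fin n} (h : G.Adj u v) :
    minor K 0 1 u v ∈ edgeIdeal K 2 G := by
  rcases lt_trichotomy u v with h' | h' | h'
  · exact Ideal.subset_span ⟨0, 1, u, v, by decide, h', h, rfl⟩
  · exact absurd h' h.ne
  · rw [minor_swap]
    exact neg_mem (Ideal.subset_span ⟨0, 1, v, u, by decide, h', h.symm, rfl⟩)

theorem minor_mem_edgeIdeal_of_eq_or_adj {G : SimpleGraph (Fin n)} {u v : Fin n}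
    (h : u = v ∨ G.Adj u v) : minor K 0 1 u v ∈ edgeIdeal K 2 G := by
  rcases h with rfl | h
  · rw [minor_self]; exact zero_mem _
  · exact minor_mem_edgeIdeal h

theorem edgeIdeal_le_iff {G : SimpleGraph (Fin n)} {I : Ideal (MvPolynomial (Fin 2 × Fin n) K)} :
    edgeIdeal K 2 G ≤ I ↔ ∀ u v, G.Adj u v → minor K 0 1 u v ∈ I := by
  constructor
  · exact fun h u v huv => h (minor_mem_edgeIdeal huv)
  · intro h
    refine Ideal.span_le.2 ?_
    rintro _ ⟨i, j, k, l, hij, -, hkl, rfl⟩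
    obtain ⟨rfl, rfl⟩ : i = 0 ∧ j = 1 := by omega
    exact h k l hkl

/-- `P_T` is the smallest ideal containing the variables of `T` and the minors of the components. -/
theorem cutIdeal_le_iff {G : SimpleGraph (Fin n)} {T : Finset (Fin n)}
    {I : Ideal (MvPolynomial (Fin 2 × Fin n) K)} :
    cutIdeal K 2 G T ≤ I ↔ (∀ r, ∀ v ∈ T, X (r, v) ∈ I) ∧
      ∀ u v (hu : u ∉ T) (hv : v ∉ T), (deleteSet G T).Reachable ⟨u, hu⟩ ⟨v, hv⟩ →
        minor K 0 1 u v ∈ I := by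
  rw [cutIdeal, sup_le_iff, iSup_le_iff]
  refine and_congr ?_ ?_
  · rw [Ideal.span_le]
    constructor
    · exact fun h r v hv => h ⟨r, v, hv, rfl⟩
    · rintro h _ ⟨r, v, hv, rfl⟩
      exact h r v hv
  · simp only [edgeIdeal_le_iff]
    constructor
    · intro h u v hu hv huv
      by_cases e : u = v
      · rw [e, minor_self]; exact zero_mem _
      · exact h ((deleteSet G T).connectedComponentMk ⟨u, hu⟩) u v
          ⟨e, ⟨hu, rfl⟩, ⟨hv, (SimpleGraph.ConnectedComponent.eq.2 huv.symm)⟩⟩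
    · rintro h c u v ⟨-, ⟨hu, rfl⟩, ⟨hv, hv'⟩⟩
      exact h u v hu hv (SimpleGraph.ConnectedComponent.eq.1 hv').symm

theorem segreMap_minor (T : Finset (Fin n)) (κ : Fin n → ℕ) (u v : Fin n) :
    segreMap K T κ (minor K 0 1 u v) =
      if u ∈ T ∨ v ∈ T then 0 else
        monomial (Finsupp.single u 1 + Finsupp.single v 1)
          (X (0, κ u) * X (1, κ v) - X (0, κ v) * X (1, κ u)) := by
  simp only [minor, map_sub, map_mul, segreMap_X]
  by_cases hu : u ∈ T
  · simp [hu]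
  by_cases hv : v ∈ T
  · simp [hv]
  simp only [hu, hv, or_self, if_false, monomial_mul]
  rw [add_comm (Finsupp.single v 1)]

theorem minor_mem_ker_segreMap {T : Finset (Fin n)} {κ : Fin n → ℕ} {u v : Fin n}
    (h : u ∉ T → v ∉ T → κ u = κ v) : minor K 0 1 u v ∈ RingHom.ker (segreMap K T κ) := by
  rw [RingHom.mem_ker, segreMap_minor]
  split_ifs with huv
  · rfl
  · rw [not_or] at huv
    rw [h huv.1 huv.2]
    simp

theorem minor_notMem_ker_segreMap {T : Finset (Fin n)} {κ : Fin n → ℕ} {u v : Fin n}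
    (hu : u ∉ T) (hv : v ∉ T) (h : κ u ≠ κ v) :
    minor K 0 1 u v ∉ RingHom.ker (segreMap K T κ) := by
  rw [RingHom.mem_ker, segreMap_minor, if_neg (by tauto), monomial_eq_zero]
  exact label_minor_ne_zero h

theorem X_mem_ker_segreMap {T : Finset (Fin n)} {κ : Fin n → ℕ} {r : Fin 2} {v : Fin n} :
    X (r, v) ∈ RingHom.ker (segreMap K T κ) ↔ v ∈ T := by
  rw [RingHom.mem_ker, segreMap_X]
  split_ifs with h <;> simp [h]

/-- Two monomials with the same image under the Segre parametrization are congruent modulo the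
variables of `T` and the minors inside the parts: as long as they differ, subtracting a
monomial multiple of a minor exchanges two rows in two columns of the same part. -/
theorem monomial_sub_monomial_mem {T : Finset (Fin n)} {κ : Fin n → ℕ}
    {I : Ideal (MvPolynomial (Fin 2 × Fin n) K)}
    (hI : ∀ u v, u ∉ T → v ∉ T → κ u = κ v → minor K 0 1 u v ∈ I) (N : ℕ)
    (m m' : Fin 2 × Fin n →₀ ℕ) (hN : ∑ v, (m (0, v) - m' (0, v)) ≤ N)
    (hm : ∀ p ∈ m.support, p.2 ∉ T)
    (h1 : ∀ v, m (0, v) + m (1, v) = m' (0, v) + m' (1, v))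
    (h2 : ∀ k, ∑ v with κ v = k, m (0, v) = ∑ v with κ v = k, m' (0, v)) :
    (monomial m 1 - monomial m' 1 : MvPolynomial (Fin 2 × Fin n) K) ∈ I := by
  classical
  induction N generalizing m with
  | zero =>
    have hle : ∀ v, m (0, v) ≤ m' (0, v) := fun v =>
      Nat.sub_eq_zero_iff_le.1 ((Finset.sum_eq_zero_iff.1 (Nat.le_zero.1 hN)) v (Finset.mem_univ v))
    have heq : ∀ v, m (0, v) = m' (0, v) := fun v =>
      (Finset.sum_eq_sum_iff_of_le fun v _ => hle v).1 (h2 (κ v)) v (by simp)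
    have : m = m' := by
      ext ⟨r, v⟩
      have := h1 v
      have := heq v
      fin_cases r
      · exact heq v
      · simp only [Fin.mk_one]; omega
    rw [this, sub_self]
    exact zero_mem _
  | succ N ih =>
    by_cases hle : ∀ v, m (0, v) ≤ m' (0, v)
    · exact ih m ((Finset.sum_eq_zero fun v _ => Nat.sub_eq_zero_of_le (hle v)).le.trans
        (Nat.zero_le _)) hm h1 h2
    push Not at hle
    obtain ⟨v, hv⟩ := hle
    obtain ⟨u, hu, huκ⟩ : ∃ u, m (0, u) < m' (0, u) ∧ κ u = κ v := by
      by_contra! hcon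
      have : ∑ w with κ w = κ v, m' (0, w) < ∑ w with κ w = κ v, m (0, w) := by
        refine Finset.sum_lt_sum (fun w hw => ?_) ⟨v, by simp, hv⟩
        by_contra! hlt
        exact hcon w hlt (by simpa using hw)
      exact this.ne (h2 _).symm
    have huv : u ≠ v := by rintro rfl; omega
    have hu1 : 0 < m (1, u) := by have := h1 u; omega
    have hv0 : 0 < m (0, v) := by omega
    set m₀ := m - (Finsupp.single (0, v) 1 + Finsupp.single (1, u) 1) with hm₀
    have hmm : m = m₀ + (Finsupp.single (0, v) 1 + Finsupp.single (1, u) 1) := by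
      ext p
      simp only [hm₀, Finsupp.add_apply, Finsupp.tsub_apply, Finsupp.single_apply]
      by_cases e1 : (0, v) = p
      · subst e1; simp; omega
      by_cases e2 : (1, u) = p
      · subst e2; simp; omega
      simp [e1, e2]
    set m₁ := m₀ + (Finsupp.single (0, u) 1 + Finsupp.single (1, v) 1) with hm₁
    have a0 : ∀ w, m (0, w) = m₀ (0, w) + if w = v then 1 else 0 := fun w => by
      conv_lhs => rw [hmm]
      simp [Finsupp.single_apply, eq_comm]
    have a1 : ∀ w, m (1, w) = m₀ (1, w) + if w = u then 1 else 0 := fun w => by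
      conv_lhs => rw [hmm]
      simp [Finsupp.single_apply, eq_comm]
    have b0 : ∀ w, m₁ (0, w) = m₀ (0, w) + if w = u then 1 else 0 := fun w => by
      simp [hm₁, Finsupp.single_apply, eq_comm]
    have b1 : ∀ w, m₁ (1, w) = m₀ (1, w) + if w = v then 1 else 0 := fun w => by
      simp [hm₁, Finsupp.single_apply, eq_comm]
    have hvT : v ∉ T := hm (0, v) (by simpa using hv0.ne')
    have huT : u ∉ T := hm (1, u) (by simpa using hu1.ne')
    have hstep : (monomial m 1 - monomial m₁ 1 : MvPolynomial (Fin 2 × Fin n) K) ∈ I := by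
      have : (monomial m 1 - monomial m₁ 1 : MvPolynomial (Fin 2 × Fin n) K) =
          monomial m₀ 1 * minor K 0 1 v u := by
        rw [hmm, hm₁, minor, X, X, X, X, monomial_mul, monomial_mul, mul_sub, monomial_mul,
          monomial_mul]
        simp
      rw [this]
      exact Ideal.mul_mem_left _ _ (hI v u hvT huT huκ.symm)
    have hrest : (monomial m₁ 1 - monomial m' 1 : MvPolynomial (Fin 2 × Fin n) K) ∈ I := by
      refine ih m₁ ?_ ?_ ?_ ?_
      · have : ∑ w, (m₁ (0, w) - m' (0, w)) < ∑ w, (m (0, w) - m' (0, w)) := by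
          refine Finset.sum_lt_sum (fun w _ => ?_) ⟨v, Finset.mem_univ _, ?_⟩
          · rw [a0, b0]
            have := a0 w
            split_ifs with e1 e2 e2
            · omega
            · subst e1; simp [e2] at this; omega
            · omega
            · omega
          · rw [a0, b0, if_pos rfl, if_neg huv.symm]
            have := a0 v
            rw [if_pos rfl] at this
            omega
        omega
      · rintro ⟨r, w⟩ hp
        by_cases ew : w = u
        · exact ew ▸ huT
        by_cases ew' : w = v
        · exact ew' ▸ hvT
        refine hm (r, w) ?_
        rw [Finsupp.mem_support_iff] at hp ⊢
        fin_cases r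
        · exact fun h => hp (by rw [← h]; simp only [Fin.zero_eta, a0, b0, ew, ew', if_false])
        · exact fun h => hp (by rw [← h]; simp only [Fin.mk_one, a1, b1, ew, ew', if_false])
      · intro w
        rw [← h1, a0, a1, b0, b1]; omega
      · intro k
        rw [← h2, Finset.sum_congr rfl fun w _ => a0 w, Finset.sum_congr rfl fun w _ => b0 w,
          Finset.sum_add_distrib, Finset.sum_add_distrib]
        congr 1
        simp [huκ]
    have := add_mem hstep hrest
    simpa using this

theorem mapDomain_apply_eq_sum {σ τ : Type*} [Fintype σ] [DecidableEq τ] (f : σ → τ)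
    (m : σ →₀ ℕ) (b : τ) : m.mapDomain f b = ∑ p, if f p = b then m p else 0 := by
  rw [Finsupp.mapDomain, Finsupp.sum_fintype _ _ (by simp), Finsupp.finsetSum_apply]
  simp [Finsupp.single_apply]

/-- The kernel of the Segre parametrization is generated by the variables of `T` and the minors
inside the parts. -/
theorem ker_segreMap_le {T : Finset (Fin n)} {κ : Fin n → ℕ}
    {I : Ideal (MvPolynomial (Fin 2 × Fin n) K)} (hT : ∀ r, ∀ v ∈ T, X (r, v) ∈ I)
    (hI : ∀ u v, u ∉ T → v ∉ T → κ u = κ v → minor K 0 1 u v ∈ I) :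
    RingHom.ker (segreMap K T κ) ≤ I := by
  classical
  -- `c (μ, e)` is a chosen monomial with image `y^μ z^e`, and `Ψ μ` sends `z^e` to its class
  let t : (Fin 2 × Fin n →₀ ℕ) → (Fin n →₀ ℕ) × (Fin 2 × ℕ →₀ ℕ) :=
    fun m => (m.mapDomain Prod.snd, m.mapDomain (Prod.map id κ))
  let good : (Fin 2 × Fin n →₀ ℕ) → Prop := fun m => ∀ p ∈ m.support, p.2 ∉ T
  let c : (Fin n →₀ ℕ) × (Fin 2 × ℕ →₀ ℕ) → (Fin 2 × Fin n →₀ ℕ) :=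
    fun x => if h : ∃ m, good m ∧ t m = x then h.choose else 0
  let Ψ : (Fin n →₀ ℕ) → MvPolynomial (Fin 2 × ℕ) K →ₗ[K] (MvPolynomial (Fin 2 × Fin n) K ⧸ I) :=
    fun μ => (basisMonomials (Fin 2 × ℕ) K).constr K fun e =>
      Ideal.Quotient.mk I (monomial (c (μ, e)) 1)
  have hΨ : ∀ μ e (a : K), Ψ μ (monomial e a) = a • Ideal.Quotient.mk I (monomial (c (μ, e)) 1) := by
    intro μ e a
    have : monomial e a = a • basisMonomials (Fin 2 × ℕ) K e := by
      simp [smul_monomial]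
    rw [this, map_smul, Module.Basis.constr_basis]
  have hmono : ∀ m (a : K), Ideal.Quotient.mk I (monomial m a) =
      Ψ (m.mapDomain Prod.snd) (coeff (m.mapDomain Prod.snd) (segreMap K T κ (monomial m a))) := by
    intro m a
    rw [segreMap_monomial]
    have ha : (monomial m a : MvPolynomial (Fin 2 × Fin n) K) = a • monomial m 1 := by
      simp [smul_monomial]
    split_ifs with h
    · obtain ⟨p, hp, hpT⟩ := h
      rw [coeff_zero, map_zero, Ideal.Quotient.eq_zero_iff_mem]
      have : (monomial m a : MvPolynomial (Fin 2 × Fin n) K) =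
          monomial (m - Finsupp.single p 1) a * X p := by
        rw [X, monomial_mul, mul_one, tsub_add_cancel_of_le]
        rw [Finsupp.single_le_iff]
        exact Nat.one_le_iff_ne_zero.2 (Finsupp.mem_support_iff.1 hp)
      rw [this]
      exact Ideal.mul_mem_left _ _ (hT p.1 p.2 hpT)
    · push Not at h
      rw [coeff_monomial, if_pos rfl, hΨ, ha]
      change _ = a • Ideal.Quotient.mk I (monomial (c (t m)) 1)
      rw [← Ideal.Quotient.mkₐ_eq_mk K, map_smul]
      congr 1
      rw [Ideal.Quotient.mkₐ_eq_mk, Ideal.Quotient.eq]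
      have hex : ∃ m', good m' ∧ t m' = t m := ⟨m, h, rfl⟩
      have hc : good (c (t m)) ∧ t (c (t m)) = t m := by
        simp only [c]
        rw [dif_pos hex]
        exact hex.choose_spec
      obtain ⟨e1, e2⟩ := Prod.mk.inj hc.2
      refine monomial_sub_monomial_mem hI _ _ _ le_rfl h ?_ ?_
      · intro v
        have := DFunLike.congr_fun e1 v
        rw [mapDomain_apply_eq_sum, mapDomain_apply_eq_sum, Fintype.sum_prod_type,
          Fintype.sum_prod_type] at this
        simpa using this.symm
      · intro k
        have := DFunLike.congr_fun e2 (0, k)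
        rw [mapDomain_apply_eq_sum, mapDomain_apply_eq_sum, Fintype.sum_prod_type,
          Fintype.sum_prod_type] at this
        simpa [Finset.sum_filter] using this.symm
  intro f hf
  rw [RingHom.mem_ker] at hf
  rw [← Ideal.Quotient.eq_zero_iff_mem]
  have hzero : ∀ μ, ∑ m ∈ f.support, Ψ μ (coeff μ (segreMap K T κ (monomial m (coeff m f)))) = 0 := by
    intro μ
    rw [← map_sum, ← coeff_sum, ← map_sum, ← f.as_sum, hf, coeff_zero, map_zero]
  have hne : ∀ m (a : K) μ, m.mapDomain Prod.snd ≠ μ →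
      coeff μ (segreMap K T κ (monomial m a)) = 0 := by
    intro m a μ h
    rw [segreMap_monomial]
    split_ifs
    · simp
    · rw [coeff_monomial, if_neg h]
  calc Ideal.Quotient.mk I f
      = ∑ m ∈ f.support, Ideal.Quotient.mk I (monomial m (coeff m f)) := by
        conv_lhs => rw [f.as_sum]
        rw [map_sum]
    _ = ∑ m ∈ f.support, ∑ μ ∈ f.support.image (Finsupp.mapDomain Prod.snd),
          Ψ μ (coeff μ (segreMap K T κ (monomial m (coeff m f)))) := by
        refine Finset.sum_congr rfl fun m hm => ?_
        rw [hmono, Finset.sum_eq_single (m.mapDomain Prod.snd)]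
        · intro μ _ h
          rw [hne m _ μ h.symm, map_zero]
        · intro h
          exact absurd (Finset.mem_image_of_mem _ hm) h
    _ = 0 := by
        rw [Finset.sum_comm]
        exact Finset.sum_eq_zero fun μ _ => hzero μ

/-! ### Closed graphs: the farthest neighbour -/

theorem IsClosedGraph.adj_of_le {G : SimpleGraph (Fin n)} (hG : IsClosedGraph G) {u x y v : Fin n}
    (huv : G.Adj u v) (hux : u ≤ x) (hxy : x < y) (hyv : y ≤ v) : G.Adj x y := by
  have h1 : G.Adj x v := by
    rcases hux.eq_or_lt with rfl | h
    · exact huv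
    · exact (hG u x v h (hxy.trans_le hyv) huv).2
  rcases hyv.eq_or_lt with rfl | h
  · exact h1
  · exact (hG x y v hxy h h1).1

theorem IsClosedGraph.adj_succ {G : SimpleGraph (Fin n)} (hG : IsClosedGraph G)
    (hc : G.Connected) {x y : Fin n} (hxy : (x : ℕ) + 1 = y) : G.Adj x y := by
  obtain ⟨p⟩ := hc.preconnected x y
  obtain ⟨d, -, h1, h2⟩ := p.exists_boundary_dart {v | v ≤ x} (le_refl x)
    (by simp only [Set.mem_ofPred_eq, not_le]; omega)
  simp only [Set.mem_ofPred_eq, not_le] at h1 h2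
  exact hG.adj_of_le d.adj h1 (by omega) (by omega)

open Classical in
/-- The largest vertex of the closed neighbourhood of `v`. -/
def next (G : SimpleGraph (Fin n)) (v : Fin n) : Fin n :=
  (Finset.univ.filter fun w => w = v ∨ G.Adj v w).max' ⟨v, by simp⟩

theorem le_next (G : SimpleGraph (Fin n)) (v : Fin n) : v ≤ next G v :=
  Finset.le_max' _ _ (by simp)

theorem le_next_of_adj {G : SimpleGraph (Fin n)} {u v : Fin n} (h : G.Adj u v) : v ≤ next G u :=
  Finset.le_max' _ _ (by simp [h])

theorem next_eq_or_adj (G : SimpleGraph (Fin n)) (v : Fin n) :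
    next G v = v ∨ G.Adj v (next G v) := by
  classical
  have := Finset.max'_mem (Finset.univ.filter fun w => w = v ∨ G.Adj v w) ⟨v, by simp⟩
  exact (Finset.mem_filter.1 this).2

theorem IsClosedGraph.adj_of_le_next {G : SimpleGraph (Fin n)} (hG : IsClosedGraph G)
    {u x y : Fin n} (hux : u ≤ x) (hxy : x < y) (hy : y ≤ next G u) : G.Adj x y := by
  rcases next_eq_or_adj G u with h | h
  · rw [h] at hy
    exact absurd (hux.trans_lt hxy) hy.not_gt
  · exact hG.adj_of_le h hux hxy hy

theorem IsClosedGraph.next_mono {G : SimpleGraph (Fin n)} (hG : IsClosedGraph G) :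
    Monotone (next G) := by
  intro u v huv
  rcases le_or_gt (next G u) v with h | h
  · exact h.trans (le_next G v)
  · exact le_next_of_adj (hG.adj_of_le_next huv h le_rfl)

theorem IsClosedGraph.lt_next {G : SimpleGraph (Fin n)} (hG : IsClosedGraph G)
    (hc : G.Connected) {v w : Fin n} (h : v < w) : v < next G v := by
  have h1 : G.Adj v ⟨v + 1, by omega⟩ := hG.adj_succ hc rfl
  exact lt_of_lt_of_le (Fin.lt_def.2 (Nat.lt_succ_self _)) (le_next_of_adj h1)

theorem iterate_next_mono (G : SimpleGraph (Fin n)) (v : Fin n) :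
    Monotone fun k => (next G)^[k] v := by
  refine monotone_nat_of_le_succ fun k => ?_
  rw [Function.iterate_succ_apply']
  exact le_next G _

theorem IsClosedGraph.exists_le_iterate_next {G : SimpleGraph (Fin n)} (hG : IsClosedGraph G)
    (hc : G.Connected) (v w : Fin n) : ∃ k, w ≤ (next G)^[k] v := by
  have key : ∀ k, w ≤ (next G)^[k] v ∨ k ≤ ((next G)^[k] v : ℕ) := by
    intro k
    induction k with
    | zero => exact Or.inr (Nat.zero_le _)
    | succ k ih =>
      by_cases h : w ≤ (next G)^[k] v
      · exact Or.inl (h.trans (iterate_next_mono G v (Nat.le_succ k)))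
      · right
        have h1 := ih.resolve_left h
        have h2 := Fin.lt_def.1 (hG.lt_next hc (not_le.1 h))
        rw [Function.iterate_succ_apply']
        omega
  rcases key n with h | h
  · exact ⟨n, h⟩
  · exact absurd h (by have := ((next G)^[n] v).isLt; omega)

/-- The number of greedy steps, each to the farthest neighbour, needed to reach or to pass `w` when
starting at `v`. -/
def steps (G : SimpleGraph (Fin n)) (v w : Fin n) : ℕ := sInf {k | w ≤ (next G)^[k] v}

theorem IsClosedGraph.le_iterate_steps {G : SimpleGraph (Fin n)} (hG : IsClosedGraph G)
    (hc : G.Connected) (v w : Fin n) : w ≤ (next G)^[steps G v w] v :=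
  Nat.sInf_mem (s := {k | w ≤ (next G)^[k] v}) (hG.exists_le_iterate_next hc v w)

theorem iterate_lt_of_lt_steps {G : SimpleGraph (Fin n)} {v w : Fin n} {k : ℕ}
    (h : k < steps G v w) : (next G)^[k] v < w :=
  not_le.1 fun h' => Nat.notMem_of_lt_sInf h h'

theorem steps_le {G : SimpleGraph (Fin n)} {v w : Fin n} {k : ℕ} (h : w ≤ (next G)^[k] v) :
    steps G v w ≤ k :=
  Nat.sInf_le h

theorem IsClosedGraph.steps_le_succ_of_adj {G : SimpleGraph (Fin n)} (hG : IsClosedGraph G)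
    (hc : G.Connected) {v u w : Fin n} (h : G.Adj u w) : steps G v w ≤ steps G v u + 1 := by
  refine steps_le ?_
  rw [Function.iterate_succ_apply']
  exact (le_next_of_adj h).trans (hG.next_mono (hG.le_iterate_steps hc v u))

theorem IsClosedGraph.steps_iterate {G : SimpleGraph (Fin n)} (hG : IsClosedGraph G)
    (hc : G.Connected) {v w : Fin n} {k : ℕ} (hk : k < steps G v w) :
    steps G v ((next G)^[k] v) = k := by
  refine le_antisymm (steps_le le_rfl) ?_
  by_contra! hlt
  have h1 := hG.le_iterate_steps hc v ((next G)^[k] v)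
  set j := steps G v ((next G)^[k] v)
  have h2 : (next G)^[j] v < (next G)^[j + 1] v := by
    rw [Function.iterate_succ_apply']
    exact hG.lt_next hc (iterate_lt_of_lt_steps (hlt.trans hk))
  exact absurd (h2.trans_le (iterate_next_mono G v hlt)) h1.not_gt

/-! ### Reduced connected dominating sets of intervals -/

theorem exists_mem_support_eq {V : Type*} {H : SimpleGraph V} {f : V → ℕ}
    (hf : ∀ u v, H.Adj u v → f v ≤ f u + 1) {u v : V} (p : H.Walk u v) {k : ℕ}
    (hu : f u ≤ k) (hv : k ≤ f v) : ∃ w ∈ p.support, f w = k := by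
  induction p with
  | nil => exact ⟨_, by simp, le_antisymm hu hv⟩
  | @cons a b c h q ih =>
    rcases hu.eq_or_lt with h' | h'
    · exact ⟨a, by simp, h'⟩
    · obtain ⟨w, hw, hwk⟩ := ih ((hf a b h).trans h') hv
      exact ⟨w, by simp [hw], hwk⟩

theorem IsReducedCDS.exists_adj {V : Type*} {H : SimpleGraph V} {D : Finset V}
    (hD : IsReducedCDS H D) {q c : V} (hq : q ∉ D) (hc : c ∉ D) (hqc : q ≠ c) :
    ∃ w, H.Adj w c ∧ (w = q ∨ w ∈ D) := by
  obtain ⟨p, -, hp⟩ := hD.2 q c hq hc hqc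
  have hadj : H.Adj p.penultimate c := p.adj_penultimate (SimpleGraph.Walk.not_nil_of_ne hqc)
  refine ⟨p.penultimate, hadj, or_iff_not_imp_left.2 fun h => ?_⟩
  exact hp _ (p.getVert_mem_support _) h hadj.ne

theorem IsReducedCDS.exists_mem_eq {V : Type*} {H : SimpleGraph V} {D : Finset V}
    (hD : IsReducedCDS H D) {f : V → ℕ} (hf : ∀ u v, H.Adj u v → f v ≤ f u + 1) {x y : V}
    (hx : x ∈ D) (hy : y ∈ D) {k : ℕ} (hxk : f x ≤ k) (hky : k ≤ f y) : ∃ z ∈ D, f z = k := by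
  obtain ⟨p⟩ := hD.1 ⟨x, hx⟩ ⟨y, hy⟩
  obtain ⟨w, -, hw⟩ := exists_mem_support_eq (H := H.induce (D : Set V)) (f := fun z => f z.1)
    (fun u v h => hf u.1 v.1 h) p hxk hky
  exact ⟨w.1, w.2, hw⟩

/-- A reduced connected dominating set meets all but two of the levels of a function that changes
by at most one along edges. Its levels form an interval of integers; if this interval contains the
bottom level but ends too early, then the top vertex and a vertex just above the interval cannot be
joined through the set, and dually. -/
theorem IsReducedCDS.le_card_add_one {V : Type*} {H : SimpleGraph V} {D : Finset V}
    (hD : IsReducedCDS H D) {f : V → ℕ} (hf : ∀ u v, H.Adj u v → f v ≤ f u + 1) {a b : V}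
    (hb : f b = 0) (hsurj : ∀ k ≤ f a, ∃ v, f v = k) : f a ≤ D.card + 1 := by
  classical
  have of_subset : ∀ A : Finset ℕ, f a ≤ A.card + 1 → A ⊆ D.image f → f a ≤ D.card + 1 := by
    intro A hA hAD
    have := (Finset.card_le_card hAD).trans Finset.card_image_le
    omega
  have of_mem : ∀ A : Finset ℕ, f a ≤ A.card + 1 → (∀ k ∈ A, ∃ z ∈ D, f z = k) →
      f a ≤ D.card + 1 := fun A hA h => of_subset A hA fun k hk => by
    obtain ⟨z, hz, hzk⟩ := h k hk
    exact Finset.mem_image.2 ⟨z, hz, hzk⟩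
  by_cases hbD : b ∈ D
  · obtain ⟨y, hy, hmax⟩ := D.exists_max_image f ⟨b, hbD⟩
    by_cases hle : f a ≤ f y + 2
    · refine of_mem (Finset.range (f a - 1)) (by simp; omega) fun k hk => ?_
      rw [Finset.mem_range] at hk
      exact hD.exists_mem_eq hf hbD hy (by omega) (by omega)
    · obtain ⟨q, hq⟩ := hsurj (f y + 1) (by omega)
      have hqD : q ∉ D := fun h => by have := hmax q h; omega
      have haD : a ∉ D := fun h => by have := hmax a h; omega
      obtain ⟨w, hwa, rfl | hw⟩ := hD.exists_adj hqD haD (by rintro rfl; omega)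
      · have := hf _ _ hwa; omega
      · have := hf _ _ hwa; have := hmax w hw; omega
  by_cases haD : a ∈ D
  · obtain ⟨x, hx, hmin⟩ := D.exists_min_image f ⟨a, haD⟩
    by_cases hle : f x ≤ 2
    · refine of_mem (Finset.Icc 2 (f a)) (by simp; omega) fun k hk => ?_
      rw [Finset.mem_Icc] at hk
      exact hD.exists_mem_eq hf hx haD (by omega) (by omega)
    · obtain ⟨q, hq⟩ := hsurj (f x - 1) (by have := hmin a haD; omega)
      have hqD : q ∉ D := fun h => by have := hmin q h; omega
      obtain ⟨w, hwb, rfl | hw⟩ := hD.exists_adj hqD hbD (by rintro rfl; omega)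
      · have := hf _ _ hwb.symm; omega
      · have := hf _ _ hwb.symm; have := hmin w hw; omega
  · by_cases hab : a = b
    · rw [hab, hb]; omega
    obtain ⟨p, -, hp⟩ := hD.2 b a hbD haD (Ne.symm hab)
    refine of_mem (Finset.Ico 1 (f a)) (by simp; omega) fun k hk => ?_
    rw [Finset.mem_Ico] at hk
    obtain ⟨w, hw, hwk⟩ := exists_mem_support_eq hf p (k := k) (by omega) (by omega)
    exact ⟨w, hp w hw (by rintro rfl; omega) (by rintro rfl; omega), hwk⟩

/-- A set that is connected and dominates its complement is a reduced connected dominating set. -/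
theorem isReducedCDS_of_dominating {V : Type*} {H : SimpleGraph V} {D : Finset V}
    (hc : (H.induce (D : Set V)).Preconnected) (hd : ∀ u, u ∉ D → ∃ d ∈ D, H.Adj u d) :
    IsReducedCDS H D := by
  classical
  refine ⟨hc, fun u v hu hv huv => ?_⟩
  obtain ⟨d, hdD, hud⟩ := hd u hu
  obtain ⟨e, heD, hve⟩ := hd v hv
  obtain ⟨p⟩ := hc ⟨d, hdD⟩ ⟨e, heD⟩
  let p' : H.Walk d e := p.map (SimpleGraph.Embedding.induce (G := H) (D : Set V)).toHom
  have hp' : ∀ w ∈ p'.support, w ∈ D := by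
    intro w hw
    rw [show p'.support = _ from SimpleGraph.Walk.support_map _ p, List.mem_map] at hw
    obtain ⟨x, -, rfl⟩ := hw
    exact x.2
  let q : H.Walk u v := SimpleGraph.Walk.cons hud (p'.concat hve.symm)
  refine ⟨q.bypass, q.bypass_isPath, fun w hw hwu hwv => ?_⟩
  have := q.support_bypass_subset_support hw
  simp only [q, SimpleGraph.Walk.support_cons, SimpleGraph.Walk.support_concat, List.mem_cons,
    List.mem_append, List.not_mem_nil, or_false] at this
  rcases this with h | h | h
  · exact absurd h hwu
  · exact hp' w h
  · exact absurd h hwv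

/-- The inner vertices of the greedy path form a reduced connected dominating set. -/
theorem IsClosedGraph.exists_isReducedCDS {G : SimpleGraph (Fin n)} (hG : IsClosedGraph G)
    (hc : G.Connected) (v w : Fin n) :
    ∃ D : Finset (Set.Icc v w), IsReducedCDS (G.induce (Set.Icc v w)) D ∧
      D.card ≤ steps G v w - 1 := by
  classical
  rcases le_or_gt (steps G v w) 1 with hm | hm
  · refine ⟨∅, ⟨fun x => absurd x.2 (by simp), fun x y _ _ hxy => ?_⟩, by simp⟩
    have hw : w ≤ next G v := (hG.le_iterate_steps hc v w).trans (iterate_next_mono G v hm)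
    have hadj : (G.induce (Set.Icc v w)).Adj x y := by
      rcases lt_or_gt_of_ne (Subtype.coe_injective.ne hxy) with h | h
      · exact hG.adj_of_le_next x.2.1 h (y.2.2.trans hw)
      · exact (hG.adj_of_le_next y.2.1 h (x.2.2.trans hw)).symm
    refine ⟨hadj.toWalk, SimpleGraph.Walk.IsPath.of_adj hadj, fun z hz hzx hzy => ?_⟩
    simp at hz
    tauto
  · have hmem : ∀ k, k < steps G v w → (next G)^[k] v ∈ Set.Icc v w := fun k hk =>
      ⟨iterate_next_mono G v (Nat.zero_le k), (iterate_lt_of_lt_steps hk).le⟩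
    let D : Finset (Set.Icc v w) := Finset.univ.filter fun x =>
      ∃ k, 1 ≤ k ∧ k < steps G v w ∧ (next G)^[k] v = x.1
    have hmemD : ∀ x, x ∈ D ↔ ∃ k, 1 ≤ k ∧ k < steps G v w ∧ (next G)^[k] v = x.1 := by
      simp [D]
    refine ⟨D, isReducedCDS_of_dominating ?_ ?_, ?_⟩
    · let P : ∀ k, 1 ≤ k → k < steps G v w → (D : Set (Set.Icc v w)) := fun k h1 h2 =>
        ⟨⟨(next G)^[k] v, hmem k h2⟩, (hmemD _).2 ⟨k, h1, h2, rfl⟩⟩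
      have hP : ∀ k (h1 : 1 ≤ k) (h2 : k < steps G v w),
          ((G.induce (Set.Icc v w)).induce (D : Set (Set.Icc v w))).Reachable
            (P 1 le_rfl hm) (P k h1 h2) := by
        intro k h1
        induction k, h1 using Nat.le_induction with
        | base => exact fun _ => SimpleGraph.Reachable.refl _
        | succ k h1 ih =>
          intro h2
          refine (ih (Nat.lt_of_succ_lt h2)).trans (SimpleGraph.Adj.reachable ?_)
          change G.Adj ((next G)^[k] v) ((next G)^[k + 1] v)
          rw [Function.iterate_succ_apply']
          exact hG.adj_of_le_next le_rfl
            (hG.lt_next hc (iterate_lt_of_lt_steps (Nat.lt_of_succ_lt h2))) le_rfl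
      have hall : ∀ x : (D : Set (Set.Icc v w)), ∃ k h1 h2, x = P k h1 h2 := by
        rintro ⟨x, hx⟩
        obtain ⟨k, h1, h2, e⟩ := (hmemD x).1 hx
        exact ⟨k, h1, h2, Subtype.ext (Subtype.ext e.symm)⟩
      intro x y
      obtain ⟨k, h1, h2, rfl⟩ := hall x
      obtain ⟨l, h3, h4, rfl⟩ := hall y
      exact (hP k h1 h2).symm.trans (hP l h3 h4)
    · intro x hx
      rcases le_or_gt x.1 (next G v) with h | h
      · refine ⟨⟨(next G)^[1] v, hmem 1 hm⟩, (hmemD _).2 ⟨1, le_rfl, hm, rfl⟩, ?_⟩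
        have hne : x.1 ≠ next G v := fun e => hx ((hmemD x).2 ⟨1, le_rfl, hm, e.symm⟩)
        exact hG.adj_of_le_next x.2.1 (lt_of_le_of_ne h hne) le_rfl
      · have hs : 1 < steps G v x.1 := by
          by_contra! h'
          exact absurd ((hG.le_iterate_steps hc v x.1).trans (iterate_next_mono G v h')) h.not_ge
        have hs' : steps G v x.1 ≤ steps G v w :=
          steps_le (x.2.2.trans (hG.le_iterate_steps hc v w))
        obtain ⟨k, hk⟩ : ∃ k, steps G v x.1 = k + 1 := ⟨steps G v x.1 - 1, by omega⟩
        -- the last vertex of the greedy path before `x` is adjacent to `x`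
        refine ⟨⟨(next G)^[k] v, hmem k (by omega)⟩, (hmemD _).2 ⟨k, by omega, by omega, rfl⟩, ?_⟩
        have h1 := hG.le_iterate_steps hc v x.1
        rw [hk, Function.iterate_succ_apply'] at h1
        exact (hG.adj_of_le_next le_rfl (iterate_lt_of_lt_steps (by omega)) h1).symm
    · have : D.image Subtype.val ⊆ (Finset.Ico 1 (steps G v w)).image fun k => (next G)^[k] v := by
        intro x hx
        obtain ⟨y, hy, rfl⟩ := Finset.mem_image.1 hx
        obtain ⟨k, h1, h2, e⟩ := (hmemD y).1 hy
        exact Finset.mem_image.2 ⟨k, Finset.mem_Ico.2 ⟨h1, h2⟩, e⟩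
      have h1 := (Finset.card_le_card this).trans Finset.card_image_le
      rwa [Finset.card_image_of_injective _ Subtype.val_injective, Nat.card_Ico] at h1

theorem IsClosedGraph.card_of_isMinReducedCDS {G : SimpleGraph (Fin n)} (hG : IsClosedGraph G)
    (hc : G.Connected) {v w : Fin n} (hvw : v ≤ w) {D : Finset (Set.Icc v w)}
    (hD : IsMinReducedCDS (G.induce (Set.Icc v w)) D) : D.card = steps G v w - 1 := by
  obtain ⟨D', hD', hcard⟩ := hG.exists_isReducedCDS hc v w
  refine le_antisymm ((hD.2 D' hD').trans hcard) ?_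
  have := hD.1.le_card_add_one (f := fun x => steps G v x.1)
    (fun x y hxy => hG.steps_le_succ_of_adj hc hxy) (a := ⟨w, hvw, le_rfl⟩)
    (b := ⟨v, le_rfl, hvw⟩) (Nat.le_zero.1 (steps_le le_rfl)) fun k hk => ?_
  · exact Nat.sub_le_of_le_add this
  · rcases hk.eq_or_lt with rfl | hk
    · exact ⟨_, rfl⟩
    · exact ⟨⟨(next G)^[k] v, iterate_next_mono G v (Nat.zero_le k),
        (iterate_lt_of_lt_steps hk).le⟩, hG.steps_iterate hc hk⟩

/-! ### Blocks of a cut set -/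

/-- The set `T` is the union of the nonempty blocks `[l_i, r_i]`, `1 ≤ i ≤ s`, which are listed from
left to right. -/
structure IsBlocks (T : Finset (Fin n)) (s : ℕ) (l r : ℕ → Fin n) : Prop where
  mem_iff : ∀ v, v ∈ T ↔ ∃ i, 1 ≤ i ∧ i ≤ s ∧ l i ≤ v ∧ v ≤ r i
  l_le_r : ∀ i, 1 ≤ i → i ≤ s → l i ≤ r i
  r_lt_l : ∀ i, 1 ≤ i → i + 1 ≤ s → r i < l (i + 1)

/-- What is used about the vertices `α_i`, `β_i` and the blocks `W_i = [l_i, r_i]`, `1 ≤ i ≤ s`, of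
the set `T`. The vertex `β_i` is the farthest neighbour of `l_i` except when it is squeezed together
with `α_{i+1}`; dually for `α_{i+1}` and `r_{i+1}`. -/
structure IsSpine (G : SimpleGraph (Fin n)) (T : Finset (Fin n)) (s : ℕ)
    (l r α β : ℕ → Fin n) : Prop extends IsBlocks T s l r where
  not_adj : ∀ i, 1 ≤ i → i ≤ s → ∀ u v, u < l i → r i < v → ¬ G.Adj u v
  α_lt : ∀ i, 1 ≤ i → i ≤ s → α i < l i
  lt_β : ∀ i, 1 ≤ i → i ≤ s → r i < β i
  adj_α : ∀ i, 1 ≤ i → i ≤ s → G.Adj (α i) (r i)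
  adj_β : ∀ i, 1 ≤ i → i ≤ s → G.Adj (l i) (β i)
  β_zero_le : ∀ v, β 0 ≤ v
  le_α_last : ∀ v, v ≤ α (s + 1)
  β_le_α : ∀ i, i ≤ s → β i ≤ α (i + 1)
  le_β_of_adj : ∀ i, 1 ≤ i → i ≤ s → (i = s ∨ β i < α (i + 1)) → ∀ w, G.Adj (l i) w → w ≤ β i
  α_le_of_adj : ∀ i, i < s → (i = 0 ∨ β i < α (i + 1)) →
    ∀ w, G.Adj w (r (i + 1)) → α (i + 1) ≤ w

/-- The number of blocks `[l_i, r_i]`, `1 ≤ i ≤ s`, to the left of `v`. Off the blocks it tells the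
components of `G \ T` apart. -/
def blockLabel (s : ℕ) (r : ℕ → Fin n) (v : Fin n) : ℕ := Nat.findGreatest (fun i => r i < v) s

theorem blockLabel_le (s : ℕ) (r : ℕ → Fin n) (v : Fin n) : blockLabel s r v ≤ s :=
  Nat.findGreatest_le s

theorem lt_of_one_le_blockLabel {s : ℕ} {r : ℕ → Fin n} {v : Fin n} (h : 1 ≤ blockLabel s r v) :
    r (blockLabel s r v) < v :=
  Nat.findGreatest_of_ne_zero (P := fun i => r i < v) rfl (by omega)

theorem le_of_blockLabel_lt {s : ℕ} {r : ℕ → Fin n} {v : Fin n} {i : ℕ}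
    (h : blockLabel s r v < i) (hi : i ≤ s) : v ≤ r i :=
  not_lt.1 (Nat.findGreatest_is_greatest (P := fun i => r i < v) h hi)

theorem le_blockLabel {s : ℕ} {r : ℕ → Fin n} {v : Fin n} {i : ℕ} (hi : i ≤ s) (h : r i < v) :
    i ≤ blockLabel s r v :=
  Nat.le_findGreatest hi h

theorem blockLabel_mono (s : ℕ) (r : ℕ → Fin n) : Monotone (blockLabel s r) := by
  intro u v huv
  rcases Nat.eq_zero_or_pos (blockLabel s r u) with h | h
  · rw [h]; exact Nat.zero_le _
  · exact le_blockLabel (blockLabel_le s r u) ((lt_of_one_le_blockLabel h).trans_le huv)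

namespace IsBlocks

variable {T : Finset (Fin n)} {s : ℕ} {l r : ℕ → Fin n}

theorem r_lt_l_of_lt (hS : IsBlocks T s l r) {i j : ℕ} (hi : 1 ≤ i) (hij : i < j)
    (hj : j ≤ s) : r i < l j := by
  induction j, hij using Nat.le_induction with
  | base => exact hS.r_lt_l i hi hj
  | succ j hij ih =>
    exact (ih (by omega)).trans_le
      ((hS.l_le_r j (by omega) (by omega)).trans (hS.r_lt_l j (by omega) hj).le)

theorem r_le_r (hS : IsBlocks T s l r) {i j : ℕ} (hi : 1 ≤ i) (hij : i ≤ j)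
    (hj : j ≤ s) : r i ≤ r j := by
  rcases hij.eq_or_lt with rfl | h
  · exact le_rfl
  · exact (hS.r_lt_l_of_lt hi h hj).le.trans (hS.l_le_r j (by omega) hj)

theorem l_le_l (hS : IsBlocks T s l r) {i j : ℕ} (hi : 1 ≤ i) (hij : i ≤ j)
    (hj : j ≤ s) : l i ≤ l j := by
  rcases hij.eq_or_lt with rfl | h
  · exact le_rfl
  · exact (hS.l_le_r i hi (by omega)).trans (hS.r_lt_l_of_lt hi h hj).le

theorem blockLabel_eq (hS : IsBlocks T s l r) {i : ℕ} {v : Fin n} (hi : i ≤ s)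
    (h1 : 1 ≤ i → r i < v) (h2 : i < s → v < l (i + 1)) : blockLabel s r v = i := by
  refine le_antisymm ?_ ?_
  · by_contra! hlt
    have h3 := lt_of_one_le_blockLabel (by omega : 1 ≤ blockLabel s r v)
    have hk := blockLabel_le s r v
    have h4 := h2 (by omega)
    have h5 := hS.l_le_l (by omega) hlt hk
    have h6 := hS.l_le_r _ (by omega) hk
    exact absurd (h4.trans_le (h5.trans h6)) h3.not_gt
  · rcases Nat.eq_zero_or_pos i with rfl | h
    · exact Nat.zero_le _
    · exact le_blockLabel hi (h1 h)

theorem notMem (hS : IsBlocks T s l r) {i : ℕ} {v : Fin n} (hi : i ≤ s)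
    (h1 : 1 ≤ i → r i < v) (h2 : i < s → v < l (i + 1)) : v ∉ T := by
  rw [hS.mem_iff]
  rintro ⟨j, hj1, hj2, hlv, hvr⟩
  rcases le_or_gt j i with h | h
  · exact absurd (h1 (by omega)) (hvr.trans (hS.r_le_r hj1 h hi)).not_gt
  · exact absurd (h2 (by omega)) ((hS.l_le_l (by omega) h hj2).trans hlv).not_gt

theorem lt_l_of_notMem (hS : IsBlocks T s l r) {v : Fin n} (hv : v ∉ T) {i : ℕ} (hi : 1 ≤ i)
    (his : i ≤ s) (h : v ≤ r i) : v < l i := by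
  by_contra! h'
  exact hv ((hS.mem_iff v).2 ⟨i, hi, his, h', h⟩)

theorem index_eq (hS : IsBlocks T s l r) {i j : ℕ} (hi : 1 ≤ i) (his : i ≤ s) (hj : 1 ≤ j)
    (hjs : j ≤ s) {v : Fin n} (h1 : l i ≤ v) (h2 : v ≤ r i) (h3 : l j ≤ v) (h4 : v ≤ r j) :
    i = j := by
  rcases lt_trichotomy i j with h | h | h
  · exact absurd (hS.r_lt_l_of_lt hi h hjs) (h3.trans h2).not_gt
  · exact h
  · exact absurd (hS.r_lt_l_of_lt hj h his) (h1.trans h4).not_gt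

end IsBlocks

namespace IsSpine

variable {G : SimpleGraph (Fin n)} {T : Finset (Fin n)} {s : ℕ} {l r α β : ℕ → Fin n}

/-- An edge between vertices with different labels starts in a block. -/
theorem of_adj_of_blockLabel_ne (hS : IsSpine G T s l r α β) {u v : Fin n} (huv : u < v)
    (hadj : G.Adj u v) (hne : blockLabel s r u ≠ blockLabel s r v) :
    1 ≤ blockLabel s r v ∧ l (blockLabel s r v) ≤ u ∧ u ≤ r (blockLabel s r v) := by
  have h1 : blockLabel s r u < blockLabel s r v :=
    lt_of_le_of_ne (blockLabel_mono s r huv.le) hne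
  have h2 : 1 ≤ blockLabel s r v := by omega
  have h3 := blockLabel_le s r v
  refine ⟨h2, ?_, le_of_blockLabel_lt h1 h3⟩
  by_contra! h4
  exact hS.not_adj _ h2 h3 u v h4 (lt_of_one_le_blockLabel h2) hadj

theorem mem_of_adj_of_blockLabel_ne (hS : IsSpine G T s l r α β) {u v : Fin n} (huv : u < v)
    (hadj : G.Adj u v) (hne : blockLabel s r u ≠ blockLabel s r v) : u ∈ T := by
  obtain ⟨h1, h2, h3⟩ := hS.of_adj_of_blockLabel_ne huv hadj hne
  exact (hS.mem_iff u).2 ⟨_, h1, blockLabel_le s r v, h2, h3⟩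

theorem reachable_iff (hG : IsClosedGraph G) (hc : G.Connected) (hS : IsSpine G T s l r α β)
    {u v : Fin n} (hu : u ∉ T) (hv : v ∉ T) :
    (deleteSet G T).Reachable ⟨u, hu⟩ ⟨v, hv⟩ ↔ blockLabel s r u = blockLabel s r v := by
  constructor
  · rintro ⟨p⟩
    have key : ∀ (x y : {v // v ∉ T}), (deleteSet G T).Walk x y →
        blockLabel s r x.1 = blockLabel s r y.1 := by
      intro x y p
      induction p with
      | nil => rfl
      | @cons a b c h q ih =>
        refine Eq.trans ?_ ih
        by_contra hne
        rcases lt_or_gt_of_ne (Subtype.coe_injective.ne h.ne) with h' | h'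
        · exact a.2 (hS.mem_of_adj_of_blockLabel_ne h' h hne)
        · exact b.2 (hS.mem_of_adj_of_blockLabel_ne h' h.symm (Ne.symm hne))
    exact key _ _ p
  · intro h
    have key : ∀ (d : ℕ) (x y : Fin n) (hx : x ∉ T) (hy : y ∉ T), (x : ℕ) + d = y →
        blockLabel s r x = blockLabel s r y → (deleteSet G T).Reachable ⟨x, hx⟩ ⟨y, hy⟩ := by
      intro d
      induction d with
      | zero =>
        intro x y hx hy hxy _
        obtain rfl : x = y := Fin.ext (by omega)
        exact SimpleGraph.Reachable.refl _
      | succ d ih =>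
        intro x y hx hy hxy hl
        let z : Fin n := ⟨x + 1, by omega⟩
        have hxz : x ≤ z := by rw [Fin.le_def]; exact Nat.le_succ _
        have hzy : z ≤ y := by rw [Fin.le_def]; change (x : ℕ) + 1 ≤ y; omega
        have hlz : blockLabel s r x = blockLabel s r z :=
          le_antisymm (blockLabel_mono s r hxz) (hl ▸ blockLabel_mono s r hzy)
        have hz : z ∉ T := by
          refine hS.notMem (blockLabel_le s r x) (fun h => ?_) (fun h => ?_)
          · exact (lt_of_one_le_blockLabel h).trans_le hxz
          · exact hzy.trans_lt (hS.lt_l_of_notMem hy (by omega) h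
              (le_of_blockLabel_lt (by omega) h))
        refine SimpleGraph.Reachable.trans (v := ⟨z, hz⟩) ?_
          (ih z y hz hy (by change (x : ℕ) + 1 + d = y; omega) (hlz.symm.trans hl))
        exact SimpleGraph.Adj.reachable (hG.adj_succ hc rfl)
    rcases le_total u v with huv | huv
    · exact key (v - u) u v hu hv (by rw [Fin.le_def] at huv; omega) h
    · exact (key (u - v) v u hv hu (by rw [Fin.le_def] at huv; omega) h.symm).symm

theorem cutIdeal_eq_ker (hG : IsClosedGraph G) (hc : G.Connected) (hS : IsSpine G T s l r α β) :
    cutIdeal K 2 G T = RingHom.ker (segreMap K T (blockLabel s r)) := by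
  refine le_antisymm (cutIdeal_le_iff.2 ⟨fun _ _ hv => X_mem_ker_segreMap.2 hv, ?_⟩)
    (ker_segreMap_le (cutIdeal_le_iff.1 le_rfl).1 ?_)
  · intro u v hu hv h
    exact minor_mem_ker_segreMap fun _ _ => (hS.reachable_iff hG hc hu hv).1 h
  · intro u v hu hv h
    exact (cutIdeal_le_iff.1 le_rfl).2 u v hu hv ((hS.reachable_iff hG hc hu hv).2 h)

theorem lt_l_succ (hS : IsSpine G T s l r α β) {i : ℕ} {v : Fin n} (h : v ≤ α (i + 1)) :
    i < s → v < l (i + 1) :=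
  fun hi => h.trans_lt (hS.α_lt (i + 1) (by omega) hi)

theorem r_lt (hS : IsSpine G T s l r α β) {i : ℕ} {v : Fin n} (his : i ≤ s) (h : β i ≤ v) :
    1 ≤ i → r i < v :=
  fun hi => (hS.lt_β i hi his).trans_le h

theorem blockLabel_eq_of_mem (hS : IsSpine G T s l r α β) {i : ℕ} {v : Fin n} (his : i ≤ s)
    (h1 : β i ≤ v) (h2 : v ≤ α (i + 1)) : blockLabel s r v = i :=
  hS.blockLabel_eq his (hS.r_lt his h1) (hS.lt_l_succ h2)

theorem notMem_of_mem (hS : IsSpine G T s l r α β) {i : ℕ} {v : Fin n} (his : i ≤ s)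
    (h1 : β i ≤ v) (h2 : v ≤ α (i + 1)) : v ∉ T :=
  hS.notMem his (hS.r_lt his h1) (hS.lt_l_succ h2)

end IsSpine

/-! ### The upper bound -/

/-- The product of the variables of the first row over the inner vertices of the greedy path. -/
def pathProd (K : Type*) [Field K] (G : SimpleGraph (Fin n)) (v w : Fin n) :
    MvPolynomial (Fin 2 × Fin n) K :=
  ∏ k ∈ Finset.Ico 1 (steps G v w), X (0, (next G)^[k] v)

/-- A witness for the local v-number: the product of the minors of the `{α_i, β_i}` and of the
variables of the first row at the inner vertices of the greedy paths from `β_i` to `α_{i+1}`. -/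
def spinePoly (K : Type*) [Field K] (G : SimpleGraph (Fin n)) (s : ℕ) (α β : ℕ → Fin n) :
    MvPolynomial (Fin 2 × Fin n) K :=
  (∏ i ∈ Finset.Icc 1 s, minor K 0 1 (α i) (β i)) *
    ∏ i ∈ Finset.range (s + 1), pathProd K G (β i) (α (i + 1))

theorem minor_isHomogeneous (u v : Fin n) :
    (minor K (0 : Fin 2) 1 u v).IsHomogeneous 2 :=
  ((isHomogeneous_X K _).mul (isHomogeneous_X K _)).sub
    ((isHomogeneous_X K _).mul (isHomogeneous_X K _))

theorem spinePoly_isHomogeneous (G : SimpleGraph (Fin n)) (s : ℕ) (α β : ℕ → Fin n) :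
    (spinePoly K G s α β).IsHomogeneous
      (2 * s + ∑ i ∈ Finset.range (s + 1), (steps G (β i) (α (i + 1)) - 1)) := by
  have h1 := IsHomogeneous.prod (Finset.Icc 1 s) (fun i => minor K 0 1 (α i) (β i)) (fun _ => 2)
    fun i _ => minor_isHomogeneous _ _
  have h2 := IsHomogeneous.prod (Finset.range (s + 1))
    (fun i => pathProd K G (β i) (α (i + 1))) (fun i => steps G (β i) (α (i + 1)) - 1)
    fun i _ => by
      have := IsHomogeneous.prod (Finset.Ico 1 (steps G (β i) (α (i + 1))))
        (fun k => (X (0, (next G)^[k] (β i)) : MvPolynomial (Fin 2 × Fin n) K)) (fun _ => 1)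
        fun k _ => isHomogeneous_X K _
      simpa [pathProd] using this
  have := h1.mul h2
  simpa [spinePoly, mul_comm] using this

theorem X_mul_minor (q : Fin 2) (u v w : Fin n) :
    (X (q, w) * minor K 0 1 u v : MvPolynomial (Fin 2 × Fin n) K) =
      X (q, u) * minor K 0 1 w v + X (q, v) * minor K 0 1 u w := by
  fin_cases q <;> simp only [minor, Fin.zero_eta, Fin.mk_one] <;> ring

theorem minor_mul_mem_of_left {I : Ideal (MvPolynomial (Fin 2 × Fin n) K)} {u v : Fin n}
    {g : MvPolynomial (Fin 2 × Fin n) K} (h : ∀ q, X (q, u) * g ∈ I) : minor K 0 1 u v * g ∈ I := by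
  have : minor K 0 1 u v * g = X (1, v) * (X (0, u) * g) - X (0, v) * (X (1, u) * g) := by
    simp only [minor]; ring
  rw [this]
  exact sub_mem (Ideal.mul_mem_left _ _ (h 0)) (Ideal.mul_mem_left _ _ (h 1))

theorem minor_mul_mem_of_right {I : Ideal (MvPolynomial (Fin 2 × Fin n) K)} {u v : Fin n}
    {g : MvPolynomial (Fin 2 × Fin n) K} (h : ∀ q, X (q, v) * g ∈ I) : minor K 0 1 u v * g ∈ I := by
  rw [minor_swap, neg_mul]
  exact neg_mem (minor_mul_mem_of_left h)

/-- If `u` and `v` are both linked to `w` modulo `I` after multiplication by `g`, then they are linked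
to each other after multiplication by `g` and a variable at `w`. -/
theorem X_mul_mul_minor_mem {I : Ideal (MvPolynomial (Fin 2 × Fin n) K)} {u v w : Fin n}
    {g : MvPolynomial (Fin 2 × Fin n) K} (h1 : g * minor K 0 1 w v ∈ I)
    (h2 : g * minor K 0 1 u w ∈ I) (q : Fin 2) : X (q, w) * (g * minor K 0 1 u v) ∈ I := by
  have : X (q, w) * (g * minor K 0 1 u v) =
      X (q, u) * (g * minor K 0 1 w v) + X (q, v) * (g * minor K 0 1 u w) := by
    linear_combination g * X_mul_minor (K := K) q u v w
  rw [this]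
  exact add_mem (Ideal.mul_mem_left _ _ h1) (Ideal.mul_mem_left _ _ h2)

theorem IsClosedGraph.prod_mul_minor_mem {G : SimpleGraph (Fin n)} (hG : IsClosedGraph G)
    {x u v : Fin n} (k : ℕ) (hxu : x ≤ u) (huv : u ≤ v) (hv : v ≤ (next G)^[k + 1] x) :
    (∏ j ∈ Finset.Ico 1 (k + 1), X (0, (next G)^[j] x)) * minor K 0 1 u v ∈
      edgeIdeal K 2 G := by
  rcases huv.eq_or_lt with rfl | huv'
  · rw [minor_self, mul_zero]; exact zero_mem _
  clear huv
  induction k generalizing v with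
  | zero => exact Ideal.mul_mem_left _ _ (minor_mem_edgeIdeal (hG.adj_of_le_next hxu huv' hv))
  | succ k ih =>
    set w := (next G)^[k + 1] x with hw
    rw [Function.iterate_succ_apply', ← hw] at hv
    rw [Finset.prod_Ico_succ_top (by omega), ← hw, mul_comm _ (X (0, w)), mul_assoc]
    rcases le_or_gt v w with h | h
    · exact Ideal.mul_mem_left _ _ (ih h huv')
    rcases le_or_gt w u with h' | h'
    · exact Ideal.mul_mem_left _ _ (Ideal.mul_mem_left _ _
        (minor_mem_edgeIdeal (hG.adj_of_le_next h' huv' hv)))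
    · exact X_mul_mul_minor_mem (Ideal.mul_mem_left _ _
        (minor_mem_edgeIdeal (hG.adj_of_le_next le_rfl h hv))) (ih le_rfl h') 0

theorem IsClosedGraph.pathProd_mul_minor_mem {G : SimpleGraph (Fin n)} (hG : IsClosedGraph G)
    (hc : G.Connected) {x y u v : Fin n} (hxu : x ≤ u) (huv : u ≤ v) (hv : v ≤ y) :
    pathProd K G x y * minor K 0 1 u v ∈ edgeIdeal K 2 G := by
  have h := hG.le_iterate_steps hc x y
  rw [pathProd]
  rcases Nat.eq_zero_or_pos (steps G x y) with h0 | h0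
  · rw [h0] at h
    obtain rfl : u = v := le_antisymm huv ((hv.trans h).trans hxu)
    rw [minor_self, mul_zero]; exact zero_mem _
  · obtain ⟨k, hk⟩ : ∃ k, steps G x y = k + 1 := ⟨steps G x y - 1, by omega⟩
    rw [hk] at h ⊢
    exact hG.prod_mul_minor_mem k hxu huv (hv.trans h)

namespace IsSpine

variable {G : SimpleGraph (Fin n)} {T : Finset (Fin n)} {s : ℕ} {l r α β : ℕ → Fin n}

theorem X_mul_minor_mem (hG : IsClosedGraph G) (hS : IsSpine G T s l r α β) {i : ℕ} (hi : 1 ≤ i)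
    (his : i ≤ s) {v : Fin n} (h1 : l i ≤ v) (h2 : v ≤ r i) (q : Fin 2) :
    (X (q, v) * minor K 0 1 (α i) (β i) : MvPolynomial (Fin 2 × Fin n) K) ∈ edgeIdeal K 2 G := by
  rw [X_mul_minor]
  refine add_mem (Ideal.mul_mem_left _ _ (minor_mem_edgeIdeal ?_))
    (Ideal.mul_mem_left _ _ (minor_mem_edgeIdeal ?_))
  · exact hG.adj_of_le (hS.adj_β i hi his) h1 (h2.trans_lt (hS.lt_β i hi his)) le_rfl
  · exact hG.adj_of_le (hS.adj_α i hi his) le_rfl ((hS.α_lt i hi his).trans_le h1) h2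

/-- Within a component of `G \ T`, the greedy path and the two adjacent minors link any two
vertices: vertices to the left of `β_i` are adjacent to `β_i`, and each term of the minor of
`{α_i, β_i}` contains a variable at `β_i`; likewise for vertices to the right of `α_{i+1}`. -/
theorem mul_minor_mem (hG : IsClosedGraph G) (hc : G.Connected) (hS : IsSpine G T s l r α β)
    {i : ℕ} (his : i ≤ s) {u v : Fin n} (huv : u ≤ v) (hu : 1 ≤ i → r i < u)
    (hv : i < s → v < l (i + 1)) :
    (if i < s then minor K 0 1 (α (i + 1)) (β (i + 1)) else 1) *
      (((if 1 ≤ i then minor K 0 1 (α i) (β i) else 1) * pathProd K G (β i) (α (i + 1))) *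
        minor K 0 1 u v) ∈ edgeIdeal K 2 G := by
  have left : ∀ w, u ≤ w → w ≤ α (i + 1) →
      ((if 1 ≤ i then minor K 0 1 (α i) (β i) else 1) * pathProd K G (β i) (α (i + 1))) *
        minor K 0 1 u w ∈ edgeIdeal K 2 G := by
    intro w huw hw
    rw [mul_assoc]
    rcases le_or_gt (β i) u with h | h
    · exact Ideal.mul_mem_left _ _ (hG.pathProd_mul_minor_mem hc h huw hw)
    have hi : 1 ≤ i := by
      by_contra h0
      obtain rfl : i = 0 := by omega
      exact absurd h (hS.β_zero_le u).not_gt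
    have hlu : l i ≤ u := (hS.l_le_r i hi his).trans (hu hi).le
    rw [if_pos hi]
    rcases le_or_gt w (β i) with h' | h'
    · refine Ideal.mul_mem_left _ _ (Ideal.mul_mem_left _ _ ?_)
      rcases huw.eq_or_lt with rfl | h''
      · exact minor_mem_edgeIdeal_of_eq_or_adj (Or.inl rfl)
      · exact minor_mem_edgeIdeal (hG.adj_of_le (hS.adj_β i hi his) hlu h'' h')
    · refine minor_mul_mem_of_right fun q => X_mul_mul_minor_mem ?_ ?_ q
      · exact hG.pathProd_mul_minor_mem hc le_rfl h'.le hw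
      · exact Ideal.mul_mem_left _ _
          (minor_mem_edgeIdeal (hG.adj_of_le (hS.adj_β i hi his) hlu h le_rfl))
  rcases le_or_gt v (α (i + 1)) with h | h
  · exact Ideal.mul_mem_left _ _ (left v huv h)
  have hi : i < s := by
    by_contra h0
    obtain rfl : i = s := by omega
    exact absurd h (hS.le_α_last v).not_gt
  have hvr : v ≤ r (i + 1) := (hv hi).le.trans (hS.l_le_r (i + 1) (by omega) hi)
  have hadj : G.Adj (α (i + 1)) v := hG.adj_of_le (hS.adj_α (i + 1) (by omega) hi) le_rfl h hvr
  rcases le_or_gt (α (i + 1)) u with h' | h'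
  · refine Ideal.mul_mem_left _ _ (Ideal.mul_mem_left _ _ ?_)
    rcases huv.eq_or_lt with rfl | h''
    · exact minor_mem_edgeIdeal_of_eq_or_adj (Or.inl rfl)
    · exact minor_mem_edgeIdeal (hG.adj_of_le (hS.adj_α (i + 1) (by omega) hi) h' h'' hvr)
  · rw [if_pos hi]
    refine minor_mul_mem_of_left fun q => X_mul_mul_minor_mem ?_ ?_ q
    · exact Ideal.mul_mem_left _ _ (minor_mem_edgeIdeal hadj)
    · exact left _ h'.le le_rfl

theorem dvd_spinePoly {i : ℕ} (his : i ≤ s) :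
    ((if i < s then minor K 0 1 (α (i + 1)) (β (i + 1)) else 1) *
      ((if 1 ≤ i then minor K 0 1 (α i) (β i) else 1) * pathProd K G (β i) (α (i + 1))) :
        MvPolynomial (Fin 2 × Fin n) K) ∣ spinePoly K G s α β := by
  rw [← mul_assoc]
  refine mul_dvd_mul ?_ (Finset.dvd_prod_of_mem (fun i => pathProd K G (β i) (α (i + 1)))
    (Finset.mem_range.2 (by omega)))
  have h1 : (if i < s then minor K (0 : Fin 2) 1 (α (i + 1)) (β (i + 1)) else 1) =
      ∏ j ∈ if i < s then {i + 1} else ∅, minor K 0 1 (α j) (β j) := by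
    split_ifs <;> simp
  have h2 : (if 1 ≤ i then minor K (0 : Fin 2) 1 (α i) (β i) else 1) =
      ∏ j ∈ if 1 ≤ i then {i} else ∅, minor K 0 1 (α j) (β j) := by
    split_ifs <;> simp
  rw [h1, h2, ← Finset.prod_union]
  · refine Finset.prod_dvd_prod_of_subset _ _ _ fun j hj => ?_
    rw [Finset.mem_Icc]
    split_ifs at hj <;> simp at hj <;> omega
  · split_ifs <;> simp

theorem minor_dvd_spinePoly {i : ℕ} (hi : 1 ≤ i) (his : i ≤ s) :
    minor K 0 1 (α i) (β i) ∣ spinePoly K G s α β :=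
  (Finset.dvd_prod_of_mem (fun i => minor K (0 : Fin 2) 1 (α i) (β i))
    (Finset.mem_Icc.2 ⟨hi, his⟩)).trans (Dvd.intro _ rfl)

theorem spinePoly_mul_mem (hG : IsClosedGraph G) (hc : G.Connected) (hS : IsSpine G T s l r α β)
    {g : MvPolynomial (Fin 2 × Fin n) K} (hg : g ∈ cutIdeal K 2 G T) :
    g * spinePoly K G s α β ∈ edgeIdeal K 2 G := by
  have key : cutIdeal K 2 G T ≤ (edgeIdeal K 2 G).colon {spinePoly K G s α β} := by
    rw [cutIdeal_le_iff]
    constructor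
    · intro q v hv
      obtain ⟨i, hi, his, h1, h2⟩ := (hS.mem_iff v).1 hv
      rw [Submodule.mem_colon_singleton, smul_eq_mul]
      obtain ⟨c, hc'⟩ := minor_dvd_spinePoly (K := K) (G := G) (α := α) (β := β) hi his
      rw [hc', ← mul_assoc]
      exact Ideal.mul_mem_right _ _ (hS.X_mul_minor_mem hG hi his h1 h2 q)
    · have main : ∀ u v (hu : u ∉ T) (hv : v ∉ T), u ≤ v →
          (deleteSet G T).Reachable ⟨u, hu⟩ ⟨v, hv⟩ →
          minor K 0 1 u v ∈ (edgeIdeal K 2 G).colon {spinePoly K G s α β} := by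
        intro u v hu hv huv h
        have hl := (hS.reachable_iff hG hc hu hv).1 h
        set i := blockLabel s r u with hi
        have his : i ≤ s := blockLabel_le s r u
        rw [Submodule.mem_colon_singleton, smul_eq_mul]
        obtain ⟨c, hc'⟩ := dvd_spinePoly (K := K) (G := G) (α := α) (β := β) his
        have := hS.mul_minor_mem (K := K) hG hc his huv (fun h => lt_of_one_le_blockLabel h)
          (fun h => hS.lt_l_of_notMem hv (by omega) h (le_of_blockLabel_lt (by omega) h))
        rw [hc', mul_comm, mul_right_comm]
        rw [← mul_assoc] at this
        exact Ideal.mul_mem_right _ _ this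
      intro u v hu hv h
      rcases le_total u v with huv | huv
      · exact main u v hu hv huv h
      · rw [minor_swap]
        exact neg_mem (main v u hv hu huv h.symm)
  have := key hg
  rwa [Submodule.mem_colon_singleton, smul_eq_mul] at this

theorem spinePoly_notMem (hS : IsSpine G T s l r α β) :
    spinePoly K G s α β ∉ RingHom.ker (segreMap K T (blockLabel s r)) := by
  rw [RingHom.mem_ker, spinePoly, map_mul, map_prod, map_prod]
  refine mul_ne_zero (Finset.prod_ne_zero_iff.2 fun i hi => ?_)
    (Finset.prod_ne_zero_iff.2 fun i hi => ?_)
  · obtain ⟨hi, his⟩ := Finset.mem_Icc.1 hi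
    obtain ⟨j, rfl⟩ : ∃ j, i = j + 1 := ⟨i - 1, by omega⟩
    have h1 := hS.β_le_α j (by omega)
    have h2 := hS.β_le_α (j + 1) his
    refine minor_notMem_ker_segreMap (hS.notMem_of_mem (by omega) h1 le_rfl)
      (hS.notMem_of_mem his le_rfl h2) ?_
    rw [hS.blockLabel_eq_of_mem (by omega) h1 le_rfl, hS.blockLabel_eq_of_mem his le_rfl h2]
    omega
  · have his : i ≤ s := by rw [Finset.mem_range] at hi; omega
    rw [pathProd, map_prod]
    refine Finset.prod_ne_zero_iff.2 fun k hk => ?_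
    rw [Finset.mem_Ico] at hk
    have : (next G)^[k] (β i) ∉ T := hS.notMem_of_mem his
      (iterate_next_mono G (β i) (Nat.zero_le k)) (iterate_lt_of_lt_steps hk.2).le
    exact fun h => this (X_mem_ker_segreMap.1 h)

theorem colon_spinePoly (hG : IsClosedGraph G) (hc : G.Connected) (hS : IsSpine G T s l r α β) :
    (edgeIdeal K 2 G).colon {spinePoly K G s α β} = cutIdeal K 2 G T := by
  refine le_antisymm (fun g hg => ?_) fun g hg => ?_
  · rw [Submodule.mem_colon_singleton, smul_eq_mul] at hg
    have hle : edgeIdeal K 2 G ≤ cutIdeal K 2 G T := by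
      rw [hS.cutIdeal_eq_ker hG hc, edgeIdeal_le_iff]
      exact fun u v huv => minor_mem_ker_segreMap fun hu hv =>
        (hS.reachable_iff hG hc hu hv).1 (SimpleGraph.Adj.reachable huv)
    have := hle hg
    rw [hS.cutIdeal_eq_ker hG hc] at this ⊢
    exact ((RingHom.ker_isPrime _).mem_or_mem this).resolve_right hS.spinePoly_notMem
  · rw [Submodule.mem_colon_singleton, smul_eq_mul]
    exact hS.spinePoly_mul_mem hG hc hg

end IsSpine

/-! ### The lower bound -/

/-- If `(J_G : f) = P_T`, then `f` lies in every prime attached to a set `T'` and a labelling that is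
constant on the edges outside `T'`, unless this prime contains `P_T`. -/
theorem mem_ker_of_colon_eq {G : SimpleGraph (Fin n)} {T T' : Finset (Fin n)} {κ : Fin n → ℕ}
    {f g : MvPolynomial (Fin 2 × Fin n) K}
    (hf : (edgeIdeal K 2 G).colon {f} = cutIdeal K 2 G T)
    (hκ : ∀ u v, u < v → G.Adj u v → u ∉ T' → v ∉ T' → κ u = κ v)
    (hg : g ∈ cutIdeal K 2 G T) (hg' : g ∉ RingHom.ker (segreMap K T' κ)) :
    f ∈ RingHom.ker (segreMap K T' κ) := by
  have hle : edgeIdeal K 2 G ≤ RingHom.ker (segreMap K T' κ) := by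
    refine edgeIdeal_le_iff.2 fun u v huv => minor_mem_ker_segreMap fun hu hv => ?_
    rcases lt_or_gt_of_ne huv.ne with h | h
    · exact hκ u v h huv hu hv
    · exact (hκ v u h huv.symm hv hu).symm
  rw [← hf, Submodule.mem_colon_singleton, smul_eq_mul] at hg
  exact ((RingHom.ker_isPrime _).mem_or_mem (hle hg)).resolve_left hg'

/-- The same in terms of monomials, for a set `T' = T₀ ∪ W` with `T₀ ⊆ T`: every monomial in the
`y_v` in the image of `f` involves a vertex of `W`. -/
theorem exists_mem_of_colon_eq {G : SimpleGraph (Fin n)} {T T₀ W : Finset (Fin n)}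
    {κ κ' : Fin n → ℕ} {f g : MvPolynomial (Fin 2 × Fin n) K} {μ : Fin n →₀ ℕ}
    (hf : (edgeIdeal K 2 G).colon {f} = cutIdeal K 2 G T)
    (hμ : coeff μ (segreMap K T κ f) ≠ 0) (hT₀ : T₀ ⊆ T)
    (hκ : ∀ u v, u < v → G.Adj u v → u ∉ T₀ ∪ W → v ∉ T₀ ∪ W → κ' u = κ' v)
    (hg : g ∈ cutIdeal K 2 G T) (hg' : g ∉ RingHom.ker (segreMap K (T₀ ∪ W) κ'))
    (ψ : ℕ → ℕ) (hψ : ∀ v, v ∉ T → ψ (κ' v) = κ v) : ∃ v ∈ W, μ v ≠ 0 := by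
  have hT : ∀ v, μ v ≠ 0 → v ∉ T := fun v hv hvT =>
    hμ (coeff_segreMap_eq_zero_of_mem hvT hv f)
  by_contra! hcon
  apply hμ
  have h1 := mem_ker_of_colon_eq hf hκ hg hg'
  rw [RingHom.mem_ker] at h1
  rw [coeff_segreMap_eq_rename (T₁ := T₀ ∪ W) (κ₁ := κ') ψ μ, h1, coeff_zero, map_zero]
  · intro v hv
    rw [Finsupp.mem_support_iff] at hv
    refine iff_of_false (fun h => ?_) (hT v hv)
    rcases Finset.mem_union.1 h with h | h
    · exact hT v hv (hT₀ h)
    · exact hv (hcon v h)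
  · intro v hv _
    rw [Finsupp.mem_support_iff] at hv
    exact hψ v (hT v hv)

namespace IsSpine

variable {G : SimpleGraph (Fin n)} {T : Finset (Fin n)} {s : ℕ} {l r α β : ℕ → Fin n}
  {f : MvPolynomial (Fin 2 × Fin n) K} {μ : Fin n →₀ ℕ}

theorem X_l_mem (hS : IsSpine G T s l r α β) {i : ℕ} (hi : 1 ≤ i) (his : i ≤ s) :
    X (0, l i) ∈ cutIdeal K 2 G T :=
  (cutIdeal_le_iff.1 le_rfl).1 0 _
    ((hS.mem_iff _).2 ⟨i, hi, his, le_rfl, hS.l_le_r i hi his⟩)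

/-- Put back `l_i` and delete instead the vertices of the component to its right that are adjacent
to it. -/
theorem exists_mem_Ioc_r_β (hS : IsSpine G T s l r α β)
    (hf : (edgeIdeal K 2 G).colon {f} = cutIdeal K 2 G T)
    (hμ : coeff μ (segreMap K T (blockLabel s r) f) ≠ 0) {i : ℕ} (hi : 1 ≤ i) (his : i ≤ s)
    (hfar : i = s ∨ β i < α (i + 1)) : ∃ v ∈ Finset.Ioc (r i) (β i), μ v ≠ 0 := by
  refine exists_mem_of_colon_eq hf hμ (T.erase_subset (l i)) (κ' := blockLabel s r) ?_
    (hS.X_l_mem hi his) ?_ id (fun _ _ => rfl)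
  · intro u v huv hadj hu hv
    by_contra hne
    obtain ⟨h1, h2, h3⟩ := hS.of_adj_of_blockLabel_ne huv hadj hne
    have huT := hS.mem_of_adj_of_blockLabel_ne huv hadj hne
    have hul : u = l i := by
      by_contra h
      exact hu (Finset.mem_union_left _ (Finset.mem_erase.2 ⟨h, huT⟩))
    subst hul
    have hk := hS.index_eq h1 (blockLabel_le s r v) hi his h2 h3 le_rfl (hS.l_le_r i hi his)
    refine hv (Finset.mem_union_right _ (Finset.mem_Ioc.2 ⟨?_, hS.le_β_of_adj i hi his hfar v hadj⟩))
    exact hk ▸ lt_of_one_le_blockLabel h1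
  · rw [X_mem_ker_segreMap, Finset.mem_union, Finset.mem_Ioc]
    rintro (h | h)
    · exact (Finset.mem_erase.1 h).1 rfl
    · exact absurd h.1 (hS.l_le_r i hi his).not_gt

/-- Put back `r_{i+1}` and delete instead the vertices of the component to its left that are
adjacent to it. -/
theorem exists_mem_Ico_α_l (hS : IsSpine G T s l r α β)
    (hf : (edgeIdeal K 2 G).colon {f} = cutIdeal K 2 G T)
    (hμ : coeff μ (segreMap K T (blockLabel s r) f) ≠ 0) {i : ℕ} (his : i < s)
    (hfar : i = 0 ∨ β i < α (i + 1)) : ∃ v ∈ Finset.Ico (α (i + 1)) (l (i + 1)), μ v ≠ 0 := by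
  have hlr := hS.l_le_r (i + 1) (by omega) his
  have hrT : r (i + 1) ∈ T := (hS.mem_iff _).2 ⟨i + 1, by omega, his, hlr, le_rfl⟩
  refine exists_mem_of_colon_eq hf hμ (T.erase_subset (r (i + 1)))
    (κ' := Function.update (blockLabel s r) (r (i + 1)) (i + 1)) ?_
    ((cutIdeal_le_iff.1 le_rfl).1 0 _ hrT) ?_ id
    (fun v hv => Function.update_of_ne (by rintro rfl; exact hv hrT) _ _)
  · intro u v huv hadj hu hv
    have hout : ∀ w, w ∉ T.erase (r (i + 1)) ∪ Finset.Ico (α (i + 1)) (l (i + 1)) →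
        w ≠ r (i + 1) → w ∉ T := fun w hw hne h =>
      hw (Finset.mem_union_left _ (Finset.mem_erase.2 ⟨hne, h⟩))
    by_cases hur : u = r (i + 1)
    · subst hur
      rw [Function.update_self, Function.update_of_ne huv.ne']
      refine (hS.blockLabel_eq his (fun _ => huv) fun h => ?_).symm
      by_contra! h'
      have h3 : r (i + 2) < v := by
        by_contra! h4
        exact hout v hv huv.ne' ((hS.mem_iff v).2 ⟨i + 2, by omega, h, h', h4⟩)
      exact hS.not_adj (i + 2) (by omega) h _ v (hS.r_lt_l (i + 1) (by omega) h) h3 hadj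
    by_cases hvr : v = r (i + 1)
    · subst hvr
      have hul := hS.lt_l_of_notMem (hout u hu hur) (by omega) his huv.le
      exact absurd (Finset.mem_union_right _ (Finset.mem_Ico.2
        ⟨hS.α_le_of_adj i his hfar u hadj, hul⟩)) hu
    · rw [Function.update_of_ne hur, Function.update_of_ne hvr]
      by_contra hne
      exact hout u hu hur (hS.mem_of_adj_of_blockLabel_ne huv hadj hne)
  · rw [X_mem_ker_segreMap, Finset.mem_union, Finset.mem_Ico]
    rintro (h | h)
    · exact (Finset.mem_erase.1 h).1 rfl
    · exact absurd h.2 hlr.not_gt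

/-- Deleting the vertices passed by one greedy step separates `β_i` from `α_{i+1}`. -/
theorem exists_mem_Ioc_iterate (hG : IsClosedGraph G) (hc : G.Connected)
    (hS : IsSpine G T s l r α β) (hf : (edgeIdeal K 2 G).colon {f} = cutIdeal K 2 G T)
    (hμ : coeff μ (segreMap K T (blockLabel s r) f) ≠ 0) {i : ℕ} (his : i ≤ s) {k : ℕ}
    (hk : k + 1 < steps G (β i) (α (i + 1))) :
    ∃ v ∈ Finset.Ioc ((next G)^[k] (β i)) ((next G)^[k + 1] (β i)), μ v ≠ 0 := by
  set p := (next G)^[k] (β i) with hp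
  set q := (next G)^[k + 1] (β i) with hq
  have hpq : q = next G p := by rw [hq, Function.iterate_succ_apply']
  have hqα : q < α (i + 1) := iterate_lt_of_lt_steps hk
  have hple : p ≤ q := hpq ▸ le_next G p
  have hβp : β i ≤ p := iterate_next_mono G (β i) (Nat.zero_le k)
  have hlp := hS.blockLabel_eq_of_mem his hβp (hple.trans hqα.le)
  have hlα := hS.blockLabel_eq_of_mem his (hS.β_le_α i his) le_rfl
  have hpT := hS.notMem_of_mem his hβp (hple.trans hqα.le)
  have hαT := hS.notMem_of_mem his (hS.β_le_α i his) le_rfl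
  -- the vertices of the component to the right of the deleted ones get the new label `s + 1`
  refine exists_mem_of_colon_eq (g := minor K 0 1 p (α (i + 1))) hf hμ (Finset.Subset.refl T)
    (κ' := fun v => if blockLabel s r v = i ∧ q < v then s + 1 else blockLabel s r v) ?_ ?_ ?_
    (fun x => if x = s + 1 then i else x) ?_
  · intro u v huv hadj hu hv
    rw [Finset.mem_union, not_or, Finset.mem_Ioc] at hu hv
    have hl : blockLabel s r u = blockLabel s r v := by
      by_contra hne
      exact hu.1 (hS.mem_of_adj_of_blockLabel_ne huv hadj hne)
    have hside : q < u ↔ q < v := by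
      refine ⟨fun h => h.trans huv, fun h => ?_⟩
      by_contra! h'
      have hup : u ≤ p := by
        by_contra! h''
        exact hu.2 ⟨h'', h'⟩
      exact absurd ((le_next_of_adj hadj).trans (hG.next_mono hup)) (hpq ▸ h).not_ge
    simp only [hl, hside]
  · exact (cutIdeal_le_iff.1 le_rfl).2 _ _ hpT hαT
      ((hS.reachable_iff hG hc hpT hαT).2 (hlp.trans hlα.symm))
  · refine minor_notMem_ker_segreMap ?_ ?_ ?_
    · simp [hpT]
    · simp [hαT, hqα]
    · simp only [hlp, hlα, hple.not_gt, hqα, and_true, and_false, if_true, if_false]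
      omega
  · intro v _
    have := blockLabel_le s r v
    split_ifs with h1 h2 h2
    · exact h1.1.symm
    · omega
    · omega
    · rfl

/-- Put back the block `[l_j, r_j]`: the coefficients in the image of `f` vanish when the labels of
the two adjacent components are identified. -/
theorem rename_coeff_eq_zero (hS : IsSpine G T s l r α β)
    (hf : (edgeIdeal K 2 G).colon {f} = cutIdeal K 2 G T)
    (hμ : coeff μ (segreMap K T (blockLabel s r) f) ≠ 0) {j : ℕ} (hjs : j + 1 ≤ s)
    (ψ : ℕ → ℕ) (hψ : ψ j = ψ (j + 1)) :
    rename (Prod.map id ψ) (coeff μ (segreMap K T (blockLabel s r) f)) = 0 := by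
  have hT : ∀ v, μ v ≠ 0 → v ∉ T := fun v hv hvT =>
    hμ (coeff_segreMap_eq_zero_of_mem hvT hv f)
  have hlr := hS.l_le_r (j + 1) (by omega) hjs
  have h1 := mem_ker_of_colon_eq (T' := T \ Finset.Icc (l (j + 1)) (r (j + 1)))
    (κ := ψ ∘ blockLabel s r) hf ?_ (hS.X_l_mem (by omega) hjs) ?_
  · rw [RingHom.mem_ker] at h1
    rw [← coeff_segreMap_eq_rename (T₂ := T \ Finset.Icc (l (j + 1)) (r (j + 1)))
      (κ₂ := ψ ∘ blockLabel s r) ψ μ, h1, coeff_zero]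
    · intro v hv
      rw [Finsupp.mem_support_iff] at hv
      exact iff_of_false (hT v hv) fun h => hT v hv (Finset.mem_sdiff.1 h).1
    · intro v _ _
      rfl
  · intro u v huv hadj hu hv
    by_cases hne : blockLabel s r u = blockLabel s r v
    · exact congrArg ψ hne
    obtain ⟨h1, h2, h3⟩ := hS.of_adj_of_blockLabel_ne huv hadj hne
    have huT := hS.mem_of_adj_of_blockLabel_ne huv hadj hne
    have hmem : u ∈ Finset.Icc (l (j + 1)) (r (j + 1)) := by
      by_contra h
      exact hu (Finset.mem_sdiff.2 ⟨huT, h⟩)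
    rw [Finset.mem_Icc] at hmem
    have hv' : blockLabel s r v = j + 1 :=
      hS.index_eq h1 (blockLabel_le s r v) (by omega) hjs h2 h3 hmem.1 hmem.2
    have hu' : blockLabel s r u = j := by
      refine le_antisymm ?_ ?_
      · have := lt_of_le_of_ne (blockLabel_mono s r huv.le) hne
        omega
      · rcases Nat.eq_zero_or_pos j with rfl | hj
        · exact Nat.zero_le _
        · exact le_blockLabel (by omega) ((hS.r_lt_l j hj hjs).trans_le hmem.1)
    simp only [Function.comp_apply, hu', hv', hψ]
  · rw [X_mem_ker_segreMap, Finset.mem_sdiff, Finset.mem_Icc]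
    exact fun h => h.2 ⟨le_rfl, hlr⟩

theorem le_sum_Ioc_iterate (hG : IsClosedGraph G) (hc : G.Connected)
    (hS : IsSpine G T s l r α β) (hf : (edgeIdeal K 2 G).colon {f} = cutIdeal K 2 G T)
    (hμ : coeff μ (segreMap K T (blockLabel s r) f) ≠ 0) {i : ℕ} (his : i ≤ s) {k : ℕ}
    (hk : k < steps G (β i) (α (i + 1))) :
    k ≤ ∑ v ∈ Finset.Ioc (β i) ((next G)^[k] (β i)), μ v := by
  classical
  induction k with
  | zero => exact Nat.zero_le _
  | succ k ih =>
    have h1 := ih (by omega)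
    obtain ⟨v, hv, hμv⟩ := hS.exists_mem_Ioc_iterate hG hc hf hμ his hk
    have h2 := Finset.single_le_sum (f := fun v => μ v) (fun _ _ => Nat.zero_le _) hv
    have hpos : 1 ≤ μ v := Nat.one_le_iff_ne_zero.2 hμv
    have h3 : β i ≤ (next G)^[k] (β i) := iterate_next_mono G (β i) (Nat.zero_le k)
    have h4 : (next G)^[k] (β i) ≤ (next G)^[k + 1] (β i) :=
      iterate_next_mono G (β i) (Nat.le_succ k)
    rw [← Finset.Ioc_union_Ioc_eq_Ioc h3 h4,
      Finset.sum_union (Finset.Ioc_disjoint_Ioc_of_le le_rfl)]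
    omega

/-- The degree of the monomial `y^μ` in the component with label `i`. If `β_i < α_{i+1}`, then `μ`
meets disjoint sets, as many as the bound. If the two vertices are squeezed together, then for
`1 ≤ i < s` the coefficient of `y^μ` vanishes when the component is merged with either of its two
neighbours, which is impossible in degree at most one. -/
theorem le_sum_block (hG : IsClosedGraph G) (hc : G.Connected)
    (hS : IsSpine G T s l r α β) (hf : (edgeIdeal K 2 G).colon {f} = cutIdeal K 2 G T)
    (hμ : coeff μ (segreMap K T (blockLabel s r) f) ≠ 0) {i : ℕ} (his : i ≤ s) :
    (if 1 ≤ i then 1 else 0) + (if i < s then 1 else 0) + (steps G (β i) (α (i + 1)) - 1) ≤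
      ∑ v with blockLabel s r v = i, μ v := by
  classical
  have of_mem : ∀ A : Finset (Fin n), (∃ v ∈ A, μ v ≠ 0) → 1 ≤ ∑ v ∈ A, μ v := by
    rintro A ⟨v, hv, hμv⟩
    exact (Nat.one_le_iff_ne_zero.2 hμv).trans
      (Finset.single_le_sum (f := fun v => μ v) (fun _ _ => Nat.zero_le _) hv)
  have hβα := hS.β_le_α i his
  -- the three groups of vertices of the component
  let A : Finset (Fin n) := if 1 ≤ i then Finset.Ioc (r i) (β i) else ∅
  let C : Finset (Fin n) := if i < s then Finset.Ico (α (i + 1)) (l (i + 1)) else ∅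
  have hA : ∀ v ∈ A, 1 ≤ i ∧ r i < v ∧ v ≤ β i := by
    intro v hv
    simp only [A] at hv
    split_ifs at hv with h
    · exact ⟨h, Finset.mem_Ioc.1 hv⟩
    · simp at hv
  have hC : ∀ v ∈ C, i < s ∧ α (i + 1) ≤ v ∧ v < l (i + 1) := by
    intro v hv
    simp only [C] at hv
    split_ifs at hv with h
    · exact ⟨h, Finset.mem_Ico.1 hv⟩
    · simp at hv
  have hAblk : ∀ v ∈ A, blockLabel s r v = i := fun v hv =>
    hS.blockLabel_eq his (fun _ => (hA v hv).2.1) (hS.lt_l_succ ((hA v hv).2.2.trans hβα))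
  have hCblk : ∀ v ∈ C, blockLabel s r v = i := fun v hv =>
    hS.blockLabel_eq his (hS.r_lt his (hβα.trans (hC v hv).2.1)) (fun _ => (hC v hv).2.2)
  have hAsum : (i = s ∨ β i < α (i + 1)) → (if 1 ≤ i then 1 else 0) ≤ ∑ v ∈ A, μ v := by
    intro h
    simp only [A]
    split_ifs with hi
    · exact of_mem _ (hS.exists_mem_Ioc_r_β hf hμ hi his h)
    · exact Nat.zero_le _
  have hCsum : (i = 0 ∨ β i < α (i + 1)) → (if i < s then 1 else 0) ≤ ∑ v ∈ C, μ v := by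
    intro h
    simp only [C]
    split_ifs with hi
    · exact of_mem _ (hS.exists_mem_Ico_α_l hf hμ hi h)
    · exact Nat.zero_le _
  have hsub : ∀ A : Finset (Fin n), (∀ v ∈ A, blockLabel s r v = i) →
      ∑ v ∈ A, μ v ≤ ∑ v with blockLabel s r v = i, μ v := fun A hA =>
    Finset.sum_le_sum_of_subset fun v hv => by simp [hA v hv]
  rcases hβα.lt_or_eq with hlt | heq
  · set m := steps G (β i) (α (i + 1)) with hm
    have hm1 : 1 ≤ m := by
      by_contra! h0
      have h1 := hG.le_iterate_steps hc (β i) (α (i + 1))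
      rw [← hm, Nat.lt_one_iff.1 h0] at h1
      exact absurd hlt (not_lt.2 h1)
    have hqα : (next G)^[m - 1] (β i) < α (i + 1) := iterate_lt_of_lt_steps (by omega)
    set B := Finset.Ioc (β i) ((next G)^[m - 1] (β i)) with hB
    have hBsum : m - 1 ≤ ∑ v ∈ B, μ v := hS.le_sum_Ioc_iterate hG hc hf hμ his (by omega)
    have hdAB : Disjoint A B := Finset.disjoint_left.2 fun v h1 h2 =>
      absurd (Finset.mem_Ioc.1 h2).1 (hA v h1).2.2.not_gt
    have hdABC : Disjoint (A ∪ B) C := by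
      refine Finset.disjoint_left.2 fun v h1 h2 => ?_
      have h3 := (hC v h2).2.1
      rcases Finset.mem_union.1 h1 with h | h
      · exact absurd (h3.trans (hA v h).2.2) hlt.not_ge
      · exact absurd (h3.trans (Finset.mem_Ioc.1 h).2) hqα.not_ge
    refine le_trans ?_ (hsub (A ∪ B ∪ C) fun v hv => ?_)
    · rw [Finset.sum_union hdABC, Finset.sum_union hdAB]
      have := hAsum (Or.inr hlt)
      have := hCsum (Or.inr hlt)
      omega
    · rcases Finset.mem_union.1 hv with h | h
      · rcases Finset.mem_union.1 h with h | h
        · exact hAblk v h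
        · rw [Finset.mem_Ioc] at h
          exact hS.blockLabel_eq_of_mem his h.1.le (h.2.trans hqα.le)
      · exact hCblk v h
  · have hm : steps G (β i) (α (i + 1)) - 1 = 0 := by
      rw [← heq, Nat.sub_eq_zero_iff_le]
      exact (steps_le (k := 0) le_rfl).trans (Nat.zero_le 1)
    rw [hm, add_zero]
    by_cases h0 : i = 0
    · rw [if_neg (by omega), zero_add]
      exact (hCsum (Or.inl h0)).trans (hsub C hCblk)
    by_cases h1 : i = s
    · rw [if_neg (by omega : ¬ i < s), add_zero]
      exact (hAsum (Or.inl h1)).trans (hsub A hAblk)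
    rw [if_pos (by omega), if_pos (by omega)]
    by_contra! hlt
    refine hμ (eq_zero_of_linear_of_rename (i := i) (j := i - 1) (k := i + 1) (by omega)
      (by omega) (coeff_segreMap_isWeightedHomogeneous T (blockLabel s r) i μ f)
      (hS.rename_coeff_eq_zero hf hμ (j := i - 1) (by omega) _ ?_)
      (hS.rename_coeff_eq_zero hf hμ (j := i) (by omega) _ ?_))
    · rw [Nat.sub_add_cancel (by omega), Function.update_self, Function.update_of_ne (by omega)]
      rfl
    · rw [Function.update_self, Function.update_of_ne (by omega)]
      rfl

theorem le_degree (hG : IsClosedGraph G) (hc : G.Connected)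
    (hS : IsSpine G T s l r α β) (hf : (edgeIdeal K 2 G).colon {f} = cutIdeal K 2 G T) {d : ℕ}
    (hd : f.IsHomogeneous d) :
    2 * s + ∑ i ∈ Finset.range (s + 1), (steps G (β i) (α (i + 1)) - 1) ≤ d := by
  have hfT : segreMap K T (blockLabel s r) f ≠ 0 := by
    intro h
    -- otherwise `f ∈ P_T`, so that `f` times the witness lies in `J_G` and the witness in `P_T`
    have h1 : f ∈ cutIdeal K 2 G T := by rw [hS.cutIdeal_eq_ker hG hc]; exact h
    have h2 := hS.spinePoly_mul_mem hG hc h1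
    rw [mul_comm, ← smul_eq_mul, ← Submodule.mem_colon_singleton, hf,
      hS.cutIdeal_eq_ker hG hc] at h2
    exact hS.spinePoly_notMem h2
  obtain ⟨μ, hμ⟩ := ne_zero_iff.1 hfT
  rw [← sum_eq_of_coeff_segreMap_ne_zero hd hμ,
    ← Finset.sum_fiberwise_of_maps_to (s := Finset.univ) (t := Finset.range (s + 1))
      (g := blockLabel s r)
      (fun v _ => Finset.mem_range.2 (Nat.lt_succ_of_le (blockLabel_le s r v)))]
  refine le_trans (le_of_eq ?_) (Finset.sum_le_sum fun i hi =>
    hS.le_sum_block hG hc hf hμ (Nat.lt_succ_iff.1 (Finset.mem_range.1 hi)))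
  have e1 : ∑ i ∈ Finset.range (s + 1), (if 1 ≤ i then 1 else 0) = s := by
    rw [Finset.sum_range_succ']; simp
  have e2 : ∑ i ∈ Finset.range (s + 1), (if i < s then 1 else 0) = s := by
    rw [Finset.sum_range_succ, Finset.sum_congr rfl fun i hi => if_pos (Finset.mem_range.1 hi)]
    simp
  rw [Finset.sum_add_distrib, Finset.sum_add_distrib, e1, e2, two_mul]

theorem localVNumber_eq (hG : IsClosedGraph G) (hc : G.Connected)
    (hS : IsSpine G T s l r α β) :
    localVNumber (edgeIdeal K 2 G) (cutIdeal K 2 G T) =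
      ((2 * s + ∑ i ∈ Finset.range (s + 1), (steps G (β i) (α (i + 1)) - 1) : ℕ) : ℕ∞) := by
  refine le_antisymm ?_ ?_
  · exact iInf₂_le _ ⟨spinePoly K G s α β, spinePoly_isHomogeneous G s α β,
      hS.colon_spinePoly hG hc⟩
  · refine le_iInf₂ fun d hd => ?_
    obtain ⟨f, hd, hf⟩ := hd
    exact_mod_cast hS.le_degree hG hc hf hd

end IsSpine

/-! ### The data of the construction -/

theorem IsBlocks.exists_notMem {T : Finset (Fin n)} {s : ℕ} {l r : ℕ → Fin n}
    (hB : IsBlocks T s l r) {i : ℕ} (his : i + 1 ≤ s)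
    (hgap : (r i : ℕ) + 1 < l (i + 1)) {x y : Fin n} (hxy : x ≤ y) (hx : x < l (i + 1))
    (hy : r i < y) : ∃ c, x ≤ c ∧ c ≤ y ∧ c ∉ T ∧ c < l (i + 1) := by
  let z : Fin n := ⟨r i + 1, by omega⟩
  have hz : r i < z := by rw [Fin.lt_def]; exact Nat.lt_succ_self _
  have hzl : z < l (i + 1) := by rw [Fin.lt_def]; exact hgap
  have hzy : z ≤ y := by rw [Fin.le_def]; exact hy
  exact ⟨max x z, le_max_left _ _, max_le hxy hzy,
    hB.notMem (by omega) (fun _ => hz.trans_le (le_max_right _ _)) (fun _ => max_lt hx hzl),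
    max_lt hx hzl⟩

namespace LData

variable {G : SimpleGraph (Fin n)} {T : Finset (Fin n)}

theorem maximal_Icc (D : LData G T) {i : ℕ} (h1 : 1 ≤ i) (h2 : i ≤ D.t) :
    Maximal G.IsClique (Set.Icc (D.a i) (D.b i)) := by
  have : Set.Icc (D.a i) (D.b i) ∈ {F : Set (Fin n) | Maximal G.IsClique F} := by
    rw [D.cliques]
    exact ⟨i, h1, h2, rfl⟩
  exact this

theorem adj_iff (D : LData G T) {u v : Fin n} (huv : u < v) :
    G.Adj u v ↔ ∃ i, 1 ≤ i ∧ i ≤ D.t ∧ D.a i ≤ u ∧ v ≤ D.b i := by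
  constructor
  · intro h
    obtain ⟨F, hF, hmax⟩ := Finite.exists_le_maximal (p := G.IsClique) (a := ({u, v} : Set (Fin n)))
      (by rw [SimpleGraph.isClique_pair]; exact fun _ => h)
    have hmem : F ∈ {F : Set (Fin n) | Maximal G.IsClique F} := hmax
    rw [D.cliques] at hmem
    obtain ⟨i, h1, h2, rfl⟩ := hmem
    exact ⟨i, h1, h2, (hF (by simp : u ∈ ({u, v} : Set (Fin n)))).1,
      (hF (by simp : v ∈ ({u, v} : Set (Fin n)))).2⟩
  · rintro ⟨i, h1, h2, h3, h4⟩
    exact (D.maximal_Icc h1 h2).1 ⟨h3, huv.le.trans h4⟩ ⟨h3.trans huv.le, h4⟩ huv.ne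

theorem a_le_b (D : LData G T) {i : ℕ} (h1 : 1 ≤ i) (h2 : i ≤ D.t) : D.a i ≤ D.b i := by
  have h := (D.maximal_Icc h1 h2).2 (y := Set.Icc (D.a i) (D.b i) ∪ {D.a i})
  by_contra! hlt
  have he : Set.Icc (D.a i) (D.b i) = ∅ := Set.Icc_eq_empty hlt.not_ge
  rw [he] at h
  exact absurd (h (by simp) (by simp) (by simp : D.a i ∈ _)) (Set.notMem_empty _)

theorem a_lt_a (D : LData G T) {i k : ℕ} (h1 : 1 ≤ i) (h2 : i < k) (h3 : k ≤ D.t) :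
    D.a i < D.a k :=
  D.a_strictMono ⟨h1, by omega⟩ ⟨by omega, h3⟩ h2

theorem a_le_a (D : LData G T) {i k : ℕ} (h1 : 1 ≤ i) (h2 : i ≤ k) (h3 : k ≤ D.t) :
    D.a i ≤ D.a k :=
  D.a_strictMono.monotoneOn ⟨h1, by omega⟩ ⟨by omega, h3⟩ h2

theorem b_lt_b (D : LData G T) {i k : ℕ} (h1 : 1 ≤ i) (h2 : i < k) (h3 : k ≤ D.t) :
    D.b i < D.b k := by
  by_contra! h
  have ha := D.a_lt_a h1 h2 h3
  have hle := (D.maximal_Icc (by omega : 1 ≤ k) h3).2 (D.maximal_Icc h1 (by omega)).1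
    (Set.Icc_subset_Icc ha.le h)
  exact absurd (hle ⟨le_rfl, D.a_le_b h1 (by omega)⟩).1 ha.not_ge

theorem b_le_b (D : LData G T) {i k : ℕ} (h1 : 1 ≤ i) (h2 : i ≤ k) (h3 : k ≤ D.t) :
    D.b i ≤ D.b k := by
  rcases h2.eq_or_lt with rfl | h
  · exact le_rfl
  · exact (D.b_lt_b h1 h h3).le

theorem le_of_a_le {D : LData G T} {i k : ℕ} (h1 : 1 ≤ k) (h2 : i ≤ D.t) (h : D.a i ≤ D.a k) :
    i ≤ k := by
  by_contra! hlt
  exact absurd (D.a_lt_a h1 hlt h2) h.not_gt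

theorem a_succ_le_b (hG : IsClosedGraph G) (hc : G.Connected) (D : LData G T) {i : ℕ} (h1 : 1 ≤ i)
    (h2 : i + 1 ≤ D.t) : D.a (i + 1) ≤ D.b i := by
  have ha := Fin.lt_def.1 (D.a_lt_a h1 (Nat.lt_add_one i) h2)
  let x : Fin n := ⟨D.a (i + 1) - 1, by omega⟩
  have hx : (x : ℕ) + 1 = D.a (i + 1) := by change (D.a (i + 1) : ℕ) - 1 + 1 = _; omega
  have hlt : x < D.a (i + 1) := by rw [Fin.lt_def]; omega
  obtain ⟨k, hk1, hk2, h3, h4⟩ := (D.adj_iff hlt).1 (hG.adj_succ hc hx)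
  have hki : k ≤ i := by
    by_contra! h
    exact absurd (h3.trans_lt hlt) (D.a_le_a (by omega) h hk2).not_gt
  exact h4.trans (D.b_le_b hk1 hki (by omega))

theorem le_b_of_adj (D : LData G T) {i : ℕ} (h1 : 1 ≤ i) (h2 : i ≤ D.t) {w : Fin n}
    (h : G.Adj (D.a i) w) : w ≤ D.b i := by
  rcases lt_or_gt_of_ne h.ne with hlt | hlt
  · obtain ⟨k, hk1, hk2, h3, h4⟩ := (D.adj_iff hlt).1 h
    exact h4.trans (D.b_le_b hk1 (le_of_a_le h1 hk2 h3) h2)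
  · exact hlt.le.trans (D.a_le_b h1 h2)

theorem a_le_of_adj (D : LData G T) {i : ℕ} (h1 : 1 ≤ i) (h2 : i ≤ D.t) {w : Fin n}
    (h : G.Adj w (D.b i)) : D.a i ≤ w := by
  rcases lt_or_gt_of_ne h.ne with hlt | hlt
  · obtain ⟨k, hk1, hk2, h3, h4⟩ := (D.adj_iff hlt).1 h
    have hik : i ≤ k := by
      by_contra! h'
      exact absurd (D.b_lt_b hk1 h' h2) h4.not_gt
    exact (D.a_le_a h1 hik hk2).trans h3
  · exact (D.a_le_b h1 h2).trans hlt.le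

theorem isBlocks (hG : IsClosedGraph G) (hc : G.Connected) (D : LData G T) :
    IsBlocks T D.s (fun i => D.a (D.j i + 1)) (fun i => D.b (D.j i)) where
  mem_iff v := by
    rw [D.T_eq]
    refine exists_congr fun i => and_congr_right fun h1 => and_congr_right fun h2 => ?_
    obtain ⟨h3, h4⟩ := D.j_mem i h1 h2
    constructor
    · exact fun h => ⟨h.2.1, h.1.2⟩
    · exact fun h => ⟨⟨(D.a_le_a h3 (Nat.le_succ _) h4).trans h.1, h.2⟩,
        h.1, h.2.trans (D.b_le_b h3 (Nat.le_succ _) h4)⟩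
  l_le_r i h1 h2 := D.a_succ_le_b hG hc (D.j_mem i h1 h2).1 (D.j_mem i h1 h2).2
  r_lt_l i h1 h2 := Fin.lt_def.2 (Nat.lt_of_succ_lt (D.gap i h1 h2))

theorem near_bounds (hG : IsClosedGraph G) (hc : G.Connected) (D : LData G T) {i : ℕ} (h1 : 1 ≤ i)
    (h2 : i + 1 ≤ D.s) (hlt : D.a (D.j (i + 1)) < D.b (D.j i + 1)) :
    D.b (D.j i) < D.β i ∧ D.β i < D.a (D.j (i + 1) + 1) := by
  have hB := D.isBlocks hG hc
  obtain ⟨h3, h4⟩ := D.j_mem i h1 (by omega)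
  obtain ⟨h5, h6⟩ := D.j_mem (i + 1) (by omega) h2
  obtain ⟨-, ⟨hmem, hT⟩, hmin⟩ := D.near i h1 h2 hlt
  constructor
  · by_contra! h
    refine hT ((hB.mem_iff _).2 ⟨i, h1, by omega, ?_, h⟩)
    have hj : D.j i < D.j (i + 1) :=
      D.j_strictMono ⟨h1, by omega⟩ ⟨by omega, h2⟩ (Nat.lt_succ_self i)
    exact (D.a_le_a (by omega) hj (by omega)).trans hmem.1
  · obtain ⟨c, hc1, hc2, hc3, hc4⟩ := hB.exists_notMem h2 (D.gap i h1 h2) hlt.le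
      (D.a_lt_a h5 (Nat.lt_succ_self _) h6) (D.b_lt_b h3 (Nat.lt_succ_self _) h4)
    exact (hmin ⟨⟨hc1, hc2⟩, hc3⟩).trans_lt hc4

theorem α_bounds (hG : IsClosedGraph G) (hc : G.Connected) (D : LData G T) {i : ℕ} (h1 : 1 ≤ i)
    (h2 : i ≤ D.s) : D.a (D.j i) ≤ D.α i ∧ D.α i < D.a (D.j i + 1) := by
  obtain ⟨h3, h4⟩ := D.j_mem i h1 h2
  have ha := D.a_lt_a h3 (Nat.lt_succ_self _) h4
  obtain ⟨k, rfl⟩ : ∃ k, i = k + 1 := ⟨i - 1, by omega⟩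
  rcases Nat.eq_zero_or_pos k with rfl | hk
  · rw [D.α_one h2]
    exact ⟨le_rfl, ha⟩
  rcases le_or_gt (D.b (D.j k + 1)) (D.a (D.j (k + 1))) with h | h
  · rw [(D.far k hk h2 h).2]
    exact ⟨le_rfl, ha⟩
  · have hn := D.near k hk h2 h
    rw [← hn.1]
    exact ⟨hn.2.1.1.1, (D.near_bounds hG hc hk h2 h).2⟩

theorem β_bounds (hG : IsClosedGraph G) (hc : G.Connected) (D : LData G T) {i : ℕ} (h1 : 1 ≤ i)
    (h2 : i ≤ D.s) : D.b (D.j i) < D.β i ∧ D.β i ≤ D.b (D.j i + 1) := by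
  obtain ⟨h3, h4⟩ := D.j_mem i h1 h2
  have hb := D.b_lt_b h3 (Nat.lt_succ_self _) h4
  rcases h2.eq_or_lt with rfl | hs
  · rw [D.β_last h1]
    exact ⟨hb, le_rfl⟩
  rcases le_or_gt (D.b (D.j i + 1)) (D.a (D.j (i + 1))) with h | h
  · rw [(D.far i h1 hs h).1]
    exact ⟨hb, le_rfl⟩
  · exact ⟨(D.near_bounds hG hc h1 hs h).1, (D.near i h1 hs h).2.1.1.2⟩

theorem isSpine (hG : IsClosedGraph G) (hc : G.Connected) (D : LData G T) :
    IsSpine G T D.s (fun i => D.a (D.j i + 1)) (fun i => D.b (D.j i)) D.α D.β where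
  toIsBlocks := D.isBlocks hG hc
  not_adj i h1 h2 u v hu hv h := by
    obtain ⟨h3, h4⟩ := D.j_mem i h1 h2
    have huv : u < v := hu.trans_le ((D.a_succ_le_b hG hc h3 h4).trans hv.le)
    obtain ⟨k, hk1, hk2, h5, h6⟩ := (D.adj_iff huv).1 h
    have hkj : k ≤ D.j i := by
      by_contra! h'
      exact absurd (h5.trans_lt hu) (D.a_le_a (by omega) h' hk2).not_gt
    exact absurd (h6.trans (D.b_le_b hk1 hkj (by omega))) hv.not_ge
  α_lt i h1 h2 := (D.α_bounds hG hc h1 h2).2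
  lt_β i h1 h2 := (D.β_bounds hG hc h1 h2).1
  adj_α i h1 h2 := by
    obtain ⟨h3, h4⟩ := D.j_mem i h1 h2
    obtain ⟨h5, h6⟩ := D.α_bounds hG hc h1 h2
    exact (D.adj_iff (h6.trans_le (D.a_succ_le_b hG hc h3 h4))).2
      ⟨D.j i, h3, by omega, h5, le_rfl⟩
  adj_β i h1 h2 := by
    obtain ⟨h3, h4⟩ := D.j_mem i h1 h2
    obtain ⟨h5, h6⟩ := D.β_bounds hG hc h1 h2
    exact (D.adj_iff ((D.a_succ_le_b hG hc h3 h4).trans_lt h5)).2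
      ⟨D.j i + 1, by omega, h4, le_rfl, h6⟩
  β_zero_le v := by rw [Fin.le_def, D.β_zero]; exact Nat.zero_le _
  le_α_last v := by rw [Fin.le_def]; have := D.α_last; omega
  β_le_α i h := by
    rcases Nat.eq_zero_or_pos i with rfl | hi
    · rw [Fin.le_def, D.β_zero]; exact Nat.zero_le _
    rcases h.eq_or_lt with rfl | hs
    · rw [Fin.le_def]; have := D.α_last; omega
    rcases le_or_gt (D.b (D.j i + 1)) (D.a (D.j (i + 1))) with h' | h'
    · rw [(D.far i hi hs h').1, (D.far i hi hs h').2]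
      exact h'
    · exact (D.near i hi hs h').1.le
  le_β_of_adj i h1 h2 hfar w hw := by
    obtain ⟨h3, h4⟩ := D.j_mem i h1 h2
    have : D.β i = D.b (D.j i + 1) := by
      rcases h2.eq_or_lt with rfl | hs
      · exact D.β_last h1
      rcases le_or_gt (D.b (D.j i + 1)) (D.a (D.j (i + 1))) with h' | h'
      · exact (D.far i h1 hs h').1
      · rcases hfar with h | h
        · omega
        · exact absurd (D.near i h1 hs h').1 h.ne
    rw [this]
    exact D.le_b_of_adj (by omega) h4 hw
  α_le_of_adj i hi hfar w hw := by
    obtain ⟨h3, h4⟩ := D.j_mem (i + 1) (by omega) hi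
    have : D.α (i + 1) = D.a (D.j (i + 1)) := by
      rcases Nat.eq_zero_or_pos i with rfl | h1
      · exact D.α_one hi
      rcases le_or_gt (D.b (D.j i + 1)) (D.a (D.j (i + 1))) with h' | h'
      · exact (D.far i h1 hi h').2
      · rcases hfar with h | h
        · omega
        · exact absurd (D.near i h1 hi h').1 h.ne
    rw [this]
    exact D.a_le_of_adj h3 (by omega) hw

theorem totalDegree_fT (hG : IsClosedGraph G) (hc : G.Connected) (D : LData G T) :
    (fT K D).totalDegree =
      2 * D.s + ∑ i ∈ Finset.range (D.s + 1), (steps G (D.β i) (D.α (i + 1)) - 1) := by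
  have hS := D.isSpine hG hc
  have hcard : ∀ i ∈ Finset.range (D.s + 1),
      (D.C i).card = steps G (D.β i) (D.α (i + 1)) - 1 := fun i hi => by
    have his : i ≤ D.s := Nat.lt_succ_iff.1 (Finset.mem_range.1 hi)
    exact hG.card_of_isMinReducedCDS hc (hS.β_le_α i his) (D.C_min i his)
  have h1 := IsHomogeneous.prod (Finset.Icc 1 D.s) (fun i => minor K 0 1 (D.α i) (D.β i))
    (fun _ => 2) fun i _ => minor_isHomogeneous _ _
  have h2 := IsHomogeneous.prod (Finset.range (D.s + 1))
    (fun i => ∏ v ∈ D.C i, (X (0, v.1) : MvPolynomial (Fin 2 × Fin n) K))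
    (fun i => (D.C i).card) fun i _ => by
      simpa using IsHomogeneous.prod (D.C i)
        (fun v => (X (0, v.1) : MvPolynomial (Fin 2 × Fin n) K)) (fun _ => 1)
        fun k _ => isHomogeneous_X K _
  have h3 : (fT K D).IsHomogeneous
      (∑ i ∈ Finset.Icc 1 D.s, 2 + ∑ i ∈ Finset.range (D.s + 1), (D.C i).card) := h1.mul h2
  rw [h3.totalDegree, Finset.sum_congr rfl hcard]
  · simp [mul_comm]
  · refine mul_ne_zero (Finset.prod_ne_zero_iff.2 fun i hi h => ?_)
      (Finset.prod_ne_zero_iff.2 fun i _ => Finset.prod_ne_zero_iff.2 fun v _ => X_ne_zero _)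
    rw [Finset.mem_Icc] at hi
    have hne : D.α i ≠ D.β i := ((hS.α_lt i hi.1 hi.2).trans_le
      ((hS.l_le_r i hi.1 hi.2).trans (hS.lt_β i hi.1 hi.2).le)).ne
    refine minor_notMem_ker_segreMap (K := K) (T := ∅) (κ := Fin.val) (by simp) (by simp)
      (Fin.val_injective.ne hne) ?_
    rw [h]
    exact zero_mem _

end LData

/-! ### Existence of the data -/

theorem exists_strictMonoOn_enum [NeZero n] (A : Finset (Fin n)) :
    ∃ a : ℕ → Fin n, StrictMonoOn a (Set.Icc 1 A.card) ∧
      ∀ v, v ∈ A ↔ ∃ i, 1 ≤ i ∧ i ≤ A.card ∧ a i = v := by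
  have key : ∀ i, 1 ≤ i → i ≤ A.card → i - 1 < A.card := fun i h1 h2 => by omega
  refine ⟨fun i => if h : i - 1 < A.card then A.orderEmbOfFin rfl ⟨i - 1, h⟩ else 0, ?_, ?_⟩
  · rintro i ⟨h1, h2⟩ k ⟨h3, h4⟩ hik
    simp only [dif_pos (key i h1 h2), dif_pos (key k h3 h4)]
    refine (A.orderEmbOfFin rfl).strictMono (Fin.lt_def.2 ?_)
    change i - 1 < k - 1
    omega
  · intro v
    constructor
    · intro hv
      have : v ∈ Set.range (A.orderEmbOfFin rfl) := by
        rw [Finset.range_orderEmbOfFin]; exact hv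
      obtain ⟨x, hx⟩ := this
      refine ⟨x + 1, by omega, x.isLt, ?_⟩
      simp only [Nat.add_sub_cancel, x.isLt, dif_pos, Fin.eta, hx]
    · rintro ⟨i, h1, h2, rfl⟩
      simp only [dif_pos (key i h1 h2)]
      exact A.orderEmbOfFin_mem rfl _

open Classical in
/-- The left end points of the maximal cliques: the vertices at which the farthest neighbour
jumps. -/
def leftEnds (G : SimpleGraph (Fin n)) : Finset (Fin n) :=
  Finset.univ.filter fun v => ∀ u < v, next G u < next G v

theorem mem_leftEnds {G : SimpleGraph (Fin n)} {v : Fin n} :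
    v ∈ leftEnds G ↔ ∀ u < v, next G u < next G v := by
  simp [leftEnds]

theorem IsClosedGraph.isClique_Icc {G : SimpleGraph (Fin n)} (hG : IsClosedGraph G) {v w : Fin n}
    (h : w ≤ next G v) : G.IsClique (Set.Icc v w) := by
  intro x hx y hy hxy
  rcases lt_or_gt_of_ne hxy with h' | h'
  · exact hG.adj_of_le_next hx.1 h' (hy.2.trans h)
  · exact (hG.adj_of_le_next hy.1 h' (hx.2.trans h)).symm

theorem le_next_of_isClique {G : SimpleGraph (Fin n)} {F : Set (Fin n)} (hF : G.IsClique F)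
    {v w : Fin n} (hv : v ∈ F) (hw : w ∈ F) : w ≤ next G v := by
  by_cases h : v = w
  · exact h ▸ le_next G v
  · exact le_next_of_adj (hF hv hw h)

theorem IsClosedGraph.maximal_isClique_iff [NeZero n] {G : SimpleGraph (Fin n)}
    (hG : IsClosedGraph G) (F : Set (Fin n)) :
    Maximal G.IsClique F ↔ ∃ v ∈ leftEnds G, F = Set.Icc v (next G v) := by
  constructor
  · rintro ⟨hF, hmax⟩
    have hne : F.Nonempty := by
      by_contra h
      rw [Set.not_nonempty_iff_eq_empty] at h
      subst h
      have := hmax (y := {(0 : Fin n)}) (by simp) (by simp)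
      exact absurd (this rfl) (Set.notMem_empty _)
    obtain ⟨v, hv, hmin⟩ := Set.exists_min_image F id F.toFinite hne
    have hsub : F ⊆ Set.Icc v (next G v) := fun w hw => ⟨hmin w hw, le_next_of_isClique hF hv hw⟩
    refine ⟨v, mem_leftEnds.2 fun u hu => ?_, hsub.antisymm (hmax (hG.isClique_Icc le_rfl) hsub)⟩
    by_contra! h
    have hsub' : F ⊆ Set.Icc u (next G u) := fun w hw =>
      ⟨hu.le.trans (hsub hw).1, (hsub hw).2.trans h⟩
    exact absurd (hmin u (hmax (hG.isClique_Icc le_rfl) hsub' ⟨le_rfl, le_next G u⟩)) hu.not_ge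
  · rintro ⟨v, hv, rfl⟩
    refine ⟨hG.isClique_Icc le_rfl, fun F hF hle w hw => ?_⟩
    have h1 : v ∈ F := hle ⟨le_rfl, le_next G v⟩
    have h2 : next G v ∈ F := hle ⟨le_next G v, le_rfl⟩
    refine ⟨?_, le_next_of_isClique hF h1 hw⟩
    by_contra! h
    exact absurd (le_next_of_isClique hF hw h2) (mem_leftEnds.1 hv w h).not_ge

theorem exists_mem_leftEnds_next_eq (G : SimpleGraph (Fin n)) (hG : IsClosedGraph G) (p : Fin n) :
    ∃ x ∈ leftEnds G, x ≤ p ∧ next G x = next G p := by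
  classical
  obtain ⟨x, hx, hmin⟩ := Finset.exists_min_image
    (Finset.univ.filter fun x => x ≤ p ∧ next G x = next G p) id ⟨p, by simp⟩
  simp only [Finset.mem_filter, Finset.mem_univ, true_and, id_eq] at hx hmin
  refine ⟨x, mem_leftEnds.2 fun u hu => lt_of_le_of_ne (hG.next_mono hu.le) fun h => ?_, hx⟩
  exact absurd (hmin u ⟨hu.le.trans hx.1, h.trans hx.2⟩) hu.not_ge

/-- A vertex of a cut set has two neighbours in different components of `G \ T`; otherwise putting
it back would not merge any components. -/
theorem IsCutSet.exists_not_reachable {G : SimpleGraph (Fin n)} {T : Finset (Fin n)}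
    (hT : IsCutSet G T) {v : Fin n} (hv : v ∈ T) :
    ∃ (x y : Fin n) (hx : x ∉ T) (hy : y ∉ T), G.Adj v x ∧ G.Adj v y ∧
      ¬ (deleteSet G T).Reachable ⟨x, hx⟩ ⟨y, hy⟩ := by
  by_contra! hcon
  have hlt := hT v hv
  have hcongr : ∀ {p q w : Fin n}, p = q → G.Adj p w → G.Adj q w := fun h h' => h ▸ h'
  -- every vertex reached in `G \ (T \ {v})` is reached in `G \ T`, and `v` only through a neighbour
  let φ : deleteSet G T →g deleteSet G (T.erase v) :=
    ⟨fun x => ⟨x.1, fun h => x.2 (Finset.mem_of_mem_erase h)⟩, fun h => h⟩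
  have key : ∀ (x : {w // w ∉ T}) (z : {w // w ∉ T.erase v}),
      (deleteSet G (T.erase v)).Reachable (φ x) z →
      (∀ hz : z.1 ∉ T, (deleteSet G T).Reachable x ⟨z.1, hz⟩) ∧
      (z.1 = v → ∃ (u : Fin n) (hu : u ∉ T), G.Adj v u ∧ (deleteSet G T).Reachable x ⟨u, hu⟩) := by
    intro x z h
    rw [SimpleGraph.reachable_iff_reflTransGen] at h
    induction h with
    | refl => exact ⟨fun _ => SimpleGraph.Reachable.refl _, fun h => absurd hv (h ▸ x.2)⟩
    | @tail y z _ hyz ih =>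
      have hadj : G.Adj y.1 z.1 := hyz
      refine ⟨fun hz => ?_, fun hz => ?_⟩
      · by_cases hy : y.1 ∈ T
        · have hyv : y.1 = v := by
            by_contra hne
            exact y.2 (Finset.mem_erase.2 ⟨hne, hy⟩)
          obtain ⟨u, hu, hvu, hxu⟩ := ih.2 hyv
          exact hxu.trans (hcon u z.1 hu hz hvu (hcongr hyv hadj))
        · exact (ih.1 hy).trans (SimpleGraph.Adj.reachable hadj)
      · have hy : y.1 ∉ T := by
          intro h
          exact y.2 (Finset.mem_erase.2 ⟨fun e => hadj.ne (e.trans hz.symm), h⟩)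
        exact ⟨y.1, hy, hcongr hz hadj.symm, ih.1 hy⟩
  have hinj : Function.Injective (SimpleGraph.ConnectedComponent.map φ) := by
    intro c d
    induction c using SimpleGraph.ConnectedComponent.ind with | _ x
    induction d using SimpleGraph.ConnectedComponent.ind with | _ y
    intro h
    rw [SimpleGraph.ConnectedComponent.map_mk, SimpleGraph.ConnectedComponent.map_mk,
      SimpleGraph.ConnectedComponent.eq] at h
    exact SimpleGraph.ConnectedComponent.eq.2 ((key x (φ y) h).1 y.2)
  exact absurd (Nat.card_le_card_of_injective _ hinj) hlt.not_ge

theorem IsCutSet.exists_lt_lt {G : SimpleGraph (Fin n)} (hG : IsClosedGraph G)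
    {T : Finset (Fin n)} (hT : IsCutSet G T) {v : Fin n} (hv : v ∈ T) :
    ∃ (x y : Fin n) (hx : x ∉ T) (hy : y ∉ T), x < v ∧ v < y ∧ G.Adj x v ∧ G.Adj v y ∧
      ¬ (deleteSet G T).Reachable ⟨x, hx⟩ ⟨y, hy⟩ := by
  obtain ⟨x, y, hx, hy, hvx, hvy, hr⟩ := hT.exists_not_reachable hv
  have hxy : x ≠ y := by
    rintro rfl
    exact hr (SimpleGraph.Reachable.refl _)
  have hnadj : ¬ G.Adj x y := fun h =>
    hr (SimpleGraph.Adj.reachable (G := deleteSet G T) (u := ⟨x, hx⟩) (v := ⟨y, hy⟩) h)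
  rcases lt_or_gt_of_ne hvx.ne with h1 | h1 <;> rcases lt_or_gt_of_ne hvy.ne with h2 | h2
  · exfalso
    rcases lt_or_gt_of_ne hxy with h | h
    · exact hnadj (hG.adj_of_le hvy h1.le h le_rfl)
    · exact hnadj (hG.adj_of_le hvx h2.le h le_rfl).symm
  · exact ⟨y, x, hy, hx, h2, h1, hvy.symm, hvx, fun h => hr h.symm⟩
  · exact ⟨x, y, hx, hy, h1, h2, hvx.symm, hvy, hr⟩
  · exfalso
    rcases lt_or_gt_of_ne hxy with h | h
    · exact hnadj (hG.adj_of_le hvx.symm le_rfl h h2.le)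
    · exact hnadj (hG.adj_of_le hvy.symm le_rfl h h1.le).symm

/-- If `(p, q)` is a gap of the complement of a cut set, then `p` is adjacent to all the vertices
between `p` and `q`, these are adjacent to `q`, and `p` is not adjacent to `q`. -/
theorem IsCutSet.adj_of_gap {G : SimpleGraph (Fin n)} (hG : IsClosedGraph G)
    {T : Finset (Fin n)} (hT : IsCutSet G T) {v p q : Fin n} (hv : v ∈ T) (hp : p ∉ T) (hq : q ∉ T)
    (hpv : p < v) (hvq : v < q) (hin : ∀ w, p < w → w < q → w ∈ T) :
    G.Adj p v ∧ G.Adj v q ∧ ¬ G.Adj p q := by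
  obtain ⟨x, y, hx, hy, hxv, hvy, hadj, hadj', hr⟩ := hT.exists_lt_lt hG hv
  have hxp : x ≤ p := by
    by_contra! h
    exact hx (hin x h (hxv.trans hvq))
  have hqy : q ≤ y := by
    by_contra! h
    exact hy (hin y (hpv.trans hvy) h)
  refine ⟨hG.adj_of_le hadj hxp hpv le_rfl, hG.adj_of_le hadj' le_rfl hvq hqy, fun hpq => hr ?_⟩
  have h1 : (deleteSet G T).Reachable ⟨x, hx⟩ ⟨p, hp⟩ := by
    rcases hxp.eq_or_lt with rfl | h
    · exact SimpleGraph.Reachable.refl _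
    · exact SimpleGraph.Adj.reachable (hG.adj_of_le hadj le_rfl h hpv.le)
  have h2 : (deleteSet G T).Reachable ⟨q, hq⟩ ⟨y, hy⟩ := by
    rcases hqy.eq_or_lt with rfl | h
    · exact SimpleGraph.Reachable.refl _
    · exact SimpleGraph.Adj.reachable (hG.adj_of_le hadj' hvq.le h le_rfl)
  exact (h1.trans (SimpleGraph.Adj.reachable (G := deleteSet G T) (u := ⟨p, hp⟩)
    (v := ⟨q, hq⟩) hpq)).trans h2

open Classical in
/-- The left end points of the maximal intervals contained in `T`. -/
def runStarts (T : Finset (Fin n)) : Finset (Fin n) :=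
  T.filter fun v => ∀ u : Fin n, (u : ℕ) + 1 = v → u ∉ T

theorem mem_runStarts {T : Finset (Fin n)} {v : Fin n} :
    v ∈ runStarts T ↔ v ∈ T ∧ ∀ u : Fin n, (u : ℕ) + 1 = v → u ∉ T := by
  simp [runStarts]

/-- The maximal intervals contained in a cut set are intersections of two consecutive maximal
cliques. -/
theorem IsCutSet.exists_index {G : SimpleGraph (Fin n)} (hG : IsClosedGraph G)
    {T : Finset (Fin n)} (hT : IsCutSet G T) {t : ℕ} {a : ℕ → Fin n}
    (ha : StrictMonoOn a (Set.Icc 1 t))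
    (hmem : ∀ v, v ∈ leftEnds G ↔ ∃ i, 1 ≤ i ∧ i ≤ t ∧ a i = v) {v : Fin n}
    (hv : v ∈ runStarts T) :
    ∃ j, 1 ≤ j ∧ j + 1 ≤ t ∧ a (j + 1) = v ∧ v ≤ next G (a j) ∧
      (∀ w, v ≤ w → w ≤ next G (a j) → w ∈ T) ∧
      ∃ q, q ∉ T ∧ (next G (a j) : ℕ) + 1 = q := by
  obtain ⟨hvT, hstart⟩ := mem_runStarts.1 hv
  obtain ⟨x, y, hx, hy, hxv, hvy, -⟩ := hT.exists_lt_lt hG hvT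
  rw [Fin.lt_def] at hxv
  -- `p` is the vertex before the interval and `q` the vertex after it
  let p : Fin n := ⟨v - 1, by omega⟩
  have hpv' : (p : ℕ) + 1 = v := by change (v : ℕ) - 1 + 1 = v; omega
  have hpv : p < v := by rw [Fin.lt_def]; omega
  have hp : p ∉ T := hstart p hpv'
  obtain ⟨q, hq, hqmin⟩ := Finset.exists_min_image (Finset.univ.filter fun w => v < w ∧ w ∉ T) id
    ⟨y, by simp [hvy, hy]⟩
  simp only [Finset.mem_filter, Finset.mem_univ, true_and, id_eq] at hq hqmin
  obtain ⟨hvq, hq⟩ := hq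
  have hin : ∀ w, p < w → w < q → w ∈ T := by
    intro w h1 h2
    by_contra hw
    rcases lt_or_ge v w with h | h
    · exact absurd (hqmin w ⟨h, hw⟩) h2.not_ge
    · have : w = v := le_antisymm h (by rw [Fin.le_def]; rw [Fin.lt_def] at h1; omega)
      exact hw (this ▸ hvT)
  have hvq' := Fin.lt_def.1 hvq
  let z : Fin n := ⟨q - 1, by omega⟩
  have hzq' : (z : ℕ) + 1 = q := by change (q : ℕ) - 1 + 1 = q; omega
  have hzq : z < q := by rw [Fin.lt_def]; omega
  have hvz : v ≤ z := by rw [Fin.le_def]; omega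
  have hpz : p < z := hpv.trans_le hvz
  obtain ⟨h1, -, hnpq⟩ := hT.adj_of_gap hG (hin z hpz hzq) hp hq hpz hzq hin
  obtain ⟨-, h2, -⟩ := hT.adj_of_gap hG hvT hp hq hpv hvq hin
  have hnext : next G p = z := by
    refine le_antisymm ?_ (le_next_of_adj h1)
    by_contra! h
    have hle : q ≤ next G p := by rw [Fin.le_def]; rw [Fin.lt_def] at h; omega
    exact hnpq (hG.adj_of_le_next le_rfl (hpz.trans hzq) hle)
  have hvA : v ∈ leftEnds G := by
    refine mem_leftEnds.2 fun u hu => ?_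
    have hup : u ≤ p := by rw [Fin.le_def]; rw [Fin.lt_def] at hu; omega
    exact ((hG.next_mono hup).trans_eq hnext).trans_lt (hzq.trans_le (le_next_of_adj h2))
  obtain ⟨k, hk1, hk2, hk⟩ := (hmem v).1 hvA
  obtain ⟨x', hx'A, hx'p, hx'⟩ := exists_mem_leftEnds_next_eq G hG p
  obtain ⟨i, hi1, hi2, hi⟩ := (hmem x').1 hx'A
  have hik : i < k := by
    by_contra! h
    have := ha.monotoneOn ⟨hk1, hk2⟩ ⟨hi1, hi2⟩ h
    rw [hk, hi] at this
    exact absurd (this.trans hx'p) hpv.not_ge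
  have hj1 : 1 ≤ k - 1 := by omega
  have hj2 : k - 1 ≤ t := by omega
  have haj : next G (a (k - 1)) = z := by
    refine le_antisymm ?_ ?_
    · rw [← hnext]
      refine hG.next_mono ?_
      have := ha ⟨hj1, hj2⟩ ⟨hk1, hk2⟩ (by omega : k - 1 < k)
      rw [hk, Fin.lt_def] at this
      rw [Fin.le_def]
      omega
    · rw [← hnext, ← hx', ← hi]
      exact hG.next_mono (ha.monotoneOn ⟨hi1, hi2⟩ ⟨hj1, hj2⟩ (by omega))
  refine ⟨k - 1, hj1, by omega, by rw [Nat.sub_add_cancel hk1, hk], haj ▸ hvz, ?_, q, hq, ?_⟩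
  · intro w h3 h4
    rw [haj] at h4
    exact hin w (hpv.trans_le h3) (h4.trans_lt hzq)
  · rw [haj, hzq']

theorem exists_mem_runStarts {T : Finset (Fin n)} {v : Fin n} (hv : v ∈ T) :
    ∃ u ∈ runStarts T, u ≤ v ∧ ∀ w, u ≤ w → w ≤ v → w ∈ T := by
  classical
  obtain ⟨u, hu, hmin⟩ := Finset.exists_min_image
    (Finset.univ.filter fun u => u ≤ v ∧ ∀ w, u ≤ w → w ≤ v → w ∈ T) id
    ⟨v, by simp only [Finset.mem_filter, Finset.mem_univ, true_and, le_refl]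
           exact fun w h1 h2 => le_antisymm h2 h1 ▸ hv⟩
  simp only [Finset.mem_filter, Finset.mem_univ, true_and, id_eq] at hu hmin
  refine ⟨u, mem_runStarts.2 ⟨hu.2 u le_rfl hu.1, fun x hx hxT => ?_⟩, hu⟩
  have hxu : x < u := by rw [Fin.lt_def]; omega
  refine absurd (hmin x ⟨hxu.le.trans hu.1, fun w h1 h2 => ?_⟩) hxu.not_ge
  rcases h1.eq_or_lt with rfl | h
  · exact hxT
  · exact hu.2 w (by rw [Fin.le_def]; rw [Fin.lt_def] at h; omega) h2

theorem IsClosedGraph.exists_isMinReducedCDS {G : SimpleGraph (Fin n)} (hG : IsClosedGraph G)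
    (hc : G.Connected) (v w : Fin n) :
    ∃ D : Finset (Set.Icc v w), IsMinReducedCDS (G.induce (Set.Icc v w)) D := by
  classical
  obtain ⟨D, hD, -⟩ := hG.exists_isReducedCDS hc v w
  obtain ⟨C, hC, hmin⟩ := Finset.exists_min_image
    (Finset.univ.filter fun D => IsReducedCDS (G.induce (Set.Icc v w)) D) Finset.card
    ⟨D, by simp [hD]⟩
  simp only [Finset.mem_filter, Finset.mem_univ, true_and] at hC hmin
  exact ⟨C, hC, hmin⟩

theorem IsCutSet.nonempty_lData {G : SimpleGraph (Fin n)} (hG : IsClosedGraph G)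
    (hc : G.Connected) {T : Finset (Fin n)} (hT : IsCutSet G T) : Nonempty (LData G T) := by
  classical
  obtain ⟨v₀⟩ := hc.nonempty
  have hn : 0 < n := v₀.pos
  have : NeZero n := ⟨hn.ne'⟩
  obtain ⟨a, ha, hmem⟩ := exists_strictMonoOn_enum (leftEnds G)
  set t := (leftEnds G).card with ht
  obtain ⟨l, hl, hlmem⟩ := exists_strictMonoOn_enum (runStarts T)
  set s := (runStarts T).card with hs
  have hidx : ∀ i, 1 ≤ i ∧ i ≤ s → ∃ j, 1 ≤ j ∧ j + 1 ≤ t ∧ a (j + 1) = l i ∧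
      l i ≤ next G (a j) ∧ (∀ w, l i ≤ w → w ≤ next G (a j) → w ∈ T) ∧
      ∃ q, q ∉ T ∧ (next G (a j) : ℕ) + 1 = q := fun i hi =>
    hT.exists_index hG ha hmem ((hlmem _).2 ⟨i, hi.1, hi.2, rfl⟩)
  choose! j hj1 hj2 hja hlb hbT hq using hidx
  have hbmono : ∀ i k, 1 ≤ i → i ≤ k → k ≤ t → next G (a i) ≤ next G (a k) :=
    fun i k h1 h2 h3 => hG.next_mono (ha.monotoneOn ⟨h1, by omega⟩ ⟨by omega, h3⟩ h2)
  have hgap : ∀ i, 1 ≤ i → i + 1 ≤ s → (next G (a (j i)) : ℕ) + 1 < l (i + 1) := by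
    intro i h1 h2
    have hlt : l i < l (i + 1) := hl ⟨h1, by omega⟩ ⟨by omega, h2⟩ (Nat.lt_add_one i)
    have hst := mem_runStarts.1 ((hlmem (l (i + 1))).2 ⟨i + 1, by omega, h2, rfl⟩)
    obtain ⟨q, hqT, hq'⟩ := hq i ⟨h1, by omega⟩
    by_contra! hle
    rcases hle.eq_or_lt with h | h
    · have : l (i + 1) = q := Fin.ext (by omega)
      exact hqT (this ▸ hst.1)
    · rw [Fin.lt_def] at hlt
      let x : Fin n := ⟨l (i + 1) - 1, by omega⟩
      have hx : (x : ℕ) + 1 = l (i + 1) := by change (l (i + 1) : ℕ) - 1 + 1 = _; omega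
      exact hst.2 x hx (hbT i ⟨h1, by omega⟩ x (by rw [Fin.le_def]; omega)
        (by rw [Fin.le_def]; omega))
  have hB : IsBlocks T s l (fun i => next G (a (j i))) := by
    refine ⟨fun v => ⟨fun hv => ?_, ?_⟩, fun i h1 h2 => hlb i ⟨h1, h2⟩,
      fun i h1 h2 => Fin.lt_def.2 (Nat.lt_of_succ_lt (hgap i h1 h2))⟩
    · obtain ⟨u, hu, huv, hall⟩ := exists_mem_runStarts hv
      obtain ⟨i, h1, h2, rfl⟩ := (hlmem u).1 hu
      refine ⟨i, h1, h2, huv, ?_⟩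
      obtain ⟨q, hqT, hq'⟩ := hq i ⟨h1, h2⟩
      have h3 := Fin.le_def.1 (hlb i ⟨h1, h2⟩)
      by_contra! h
      rw [Fin.lt_def] at h
      exact hqT (hall q (by rw [Fin.le_def]; omega) (by rw [Fin.le_def]; omega))
    · rintro ⟨i, h1, h2, h3, h4⟩
      exact hbT i ⟨h1, h2⟩ v h3 h4
  have hnear : ∀ i, 1 ≤ i ∧ i + 1 ≤ s ∧ a (j (i + 1)) < next G (a (j i + 1)) → ∃ c,
      IsLeast (Set.Icc (a (j (i + 1))) (next G (a (j i + 1))) \ (T : Set (Fin n))) c := by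
    rintro i ⟨h1, h2, h3⟩
    have h4 := hj2 i ⟨h1, by omega⟩
    have h5 := hj2 (i + 1) ⟨by omega, h2⟩
    have h6 := hj1 (i + 1) ⟨by omega, h2⟩
    have h7 := hja (i + 1) ⟨by omega, h2⟩
    have hx : a (j (i + 1)) < l (i + 1) := by
      rw [← h7]
      exact ha ⟨h6, by omega⟩ ⟨by omega, h5⟩ (Nat.lt_add_one _)
    have hy : next G (a (j i)) < next G (a (j i + 1)) := by
      have := hj1 i ⟨h1, by omega⟩
      exact mem_leftEnds.1 ((hmem _).2 ⟨j i + 1, by omega, h4, rfl⟩) _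
        (ha ⟨this, by omega⟩ ⟨by omega, h4⟩ (Nat.lt_add_one _))
    obtain ⟨c, hc1, hc2, hc3, -⟩ := hB.exists_notMem h2 (hgap i h1 h2) h3.le hx hy
    obtain ⟨d, hd, hmin⟩ := Set.exists_min_image
      (Set.Icc (a (j (i + 1))) (next G (a (j i + 1))) \ (T : Set (Fin n))) id (Set.toFinite _)
      ⟨c, ⟨hc1, hc2⟩, hc3⟩
    exact ⟨d, hd, fun x hx => hmin x hx⟩
  choose! γ hγ using hnear
  let α : ℕ → Fin n := fun i => if i = s + 1 then ⟨n - 1, by omega⟩ else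
    if i = 1 ∨ next G (a (j (i - 1) + 1)) ≤ a (j i) then a (j i) else γ (i - 1)
  let β : ℕ → Fin n := fun i => if i = 0 then 0 else
    if i = s ∨ next G (a (j i + 1)) ≤ a (j (i + 1)) then next G (a (j i + 1)) else γ i
  choose C hC using fun i => hG.exists_isMinReducedCDS hc (β i) (α (i + 1))
  refine ⟨{
    t := t
    a := a
    b := fun i => next G (a i)
    t_pos := ?_
    a_strictMono := ha
    cliques := ?_
    s := s
    j := j
    j_mem := fun i h1 h2 => ⟨hj1 i ⟨h1, h2⟩, hj2 i ⟨h1, h2⟩⟩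
    j_strictMono := ?_
    T_eq := ?_
    gap := fun i h1 h2 => (hja (i + 1) ⟨by omega, h2⟩).symm ▸ hgap i h1 h2
    α := α
    β := β
    β_zero := by simp [β]
    α_last := by simp [α]; omega
    α_one := fun h => by simp [α]; omega
    β_last := fun h => by simp [β]; omega
    far := ?_
    near := ?_
    C := C
    C_min := fun i _ => hC i }⟩
  · rw [ht, Nat.one_le_iff_ne_zero, ← Nat.pos_iff_ne_zero, Finset.card_pos]
    exact ⟨0, mem_leftEnds.2 fun u hu => absurd hu (Fin.not_lt_zero u)⟩
  · ext F
    rw [Set.mem_ofPred_eq, Set.mem_ofPred_eq, hG.maximal_isClique_iff]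
    constructor
    · rintro ⟨v, hv, rfl⟩
      obtain ⟨i, h1, h2, rfl⟩ := (hmem v).1 hv
      exact ⟨i, h1, h2, rfl⟩
    · rintro ⟨i, h1, h2, rfl⟩
      exact ⟨a i, (hmem _).2 ⟨i, h1, h2, rfl⟩, rfl⟩
  · rintro i hi k hk hik
    by_contra! hle
    have h1 := ha.monotoneOn ⟨by omega, hj2 k hk⟩ ⟨by omega, hj2 i hi⟩ (Nat.add_le_add_right hle 1)
    rw [hja i hi, hja k hk] at h1
    exact absurd (hl hi hk hik) h1.not_gt
  · intro v
    rw [hB.mem_iff]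
    refine exists_congr fun i => and_congr_right fun h1 => and_congr_right fun h2 => ?_
    have h3 := hj1 i ⟨h1, h2⟩
    have h4 := hj2 i ⟨h1, h2⟩
    have h5 := hja i ⟨h1, h2⟩
    rw [← h5]
    constructor
    · exact fun h => ⟨⟨(ha.monotoneOn ⟨h3, by omega⟩ ⟨by omega, h4⟩ (Nat.le_succ _)).trans h.1,
        h.2⟩, h.1, h.2.trans (hbmono _ _ h3 (Nat.le_succ _) h4)⟩
    · exact fun h => ⟨h.2.1, h.1.2⟩
  · intro i h1 h2 h3
    constructor
    · simp only [β]
      rw [if_neg (by omega), if_pos (Or.inr h3)]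
    · simp only [α, Nat.add_sub_cancel]
      rw [if_neg (by omega), if_pos (Or.inr h3)]
  · intro i h1 h2 h3
    have e1 : β i = γ i := by
      simp only [β]
      rw [if_neg (by omega), if_neg]
      rintro (h | h)
      · omega
      · exact absurd h3 h.not_gt
    have e2 : α (i + 1) = γ i := by
      simp only [α]
      rw [if_neg (by omega), if_neg]
      · rfl
      rintro (h | h)
      · omega
      · exact absurd h3 (not_lt.2 h)
    exact ⟨e1.trans e2.symm, e1 ▸ hγ i ⟨h1, h2, h3⟩⟩

end BinomialEdge

end

theorem mainTheorem3 {K : Type*} [Field K] {n : ℕ} (G : SimpleGraph (Fin n))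
    (hconn : G.Connected) (hclosed : BinomialEdge.IsClosedGraph G)
    (T : Finset (Fin n)) (hT : BinomialEdge.IsCutSet G T) :
    Nonempty (BinomialEdge.LData G T) ∧
      ∀ D : BinomialEdge.LData G T,
        BinomialEdge.localVNumber (BinomialEdge.edgeIdeal K 2 G) (BinomialEdge.cutIdeal K 2 G T) =
          ((BinomialEdge.fT K D).totalDegree : ℕ∞) := by
  refine ⟨hT.nonempty_lData hclosed hconn, fun D => ?_⟩
  rw [(D.isSpine hclosed hconn).localVNumber_eq hclosed hconn,
    D.totalDegree_fT hclosed hconn]
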